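/- Let $c$ be a real number with $1<c<7/6$. For real $X>0$ put $$S_c(X)=\sum_{X/2<n\le X}\mu^2([n^c])\,\mu^2([n^c]+1),$$ where $n$ runs over positive integers, $\mu$ is the Möbius function and $[t]$ is the integer part of $t$. Let $\sigma=\prod_p\left(1-\frac{2}{p^2}\right)$, the product being over all primes. Then for every $\varepsilon>0$, $$S_c(X)=\tfrac12\,\sigma X+O\!\left(X^{\frac{6c+1}{8}+\varepsilon}\right)\qquad(X\to\infty,\ X\in\mathbb{R}),$$ where the implied constant depends only on $c$ and $\varepsilon$. In particular, there are infinitely many positive integers $n$ for which $[n^c]$ and $[n^c]+1$ are both square-free. -/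

import Mathlib

open Filter Asymptotics

namespace ConsecutiveSquarefree

/-- The constant `σ = ∏_p (1 - 2 / p ^ 2)`, the product running over all primes. -/
noncomputable def sigma : ℝ := ∏' p : Nat.Primes, (1 - 2 / ((p : ℕ) : ℝ) ^ 2)

/-- The product defining `sigma` converges (unconditionally), so `sigma` is its actual value. -/
theorem multipliable_sigma :
    Multipliable fun p : Nat.Primes => (1 - 2 / ((p : ℕ) : ℝ) ^ 2) := by
  have h : Summable fun p : Nat.Primes => -(2 / ((p : ℕ) : ℝ) ^ 2) := by
    have h0 : Summable fun n : ℕ => 2 / (n : ℝ) ^ 2 := by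
      simpa [div_eq_mul_inv] using
        (Real.summable_nat_pow_inv.mpr (by norm_num : 1 < 2)).mul_left (2 : ℝ)
    exact (h0.comp_injective Nat.Primes.coe_nat_injective).neg
  simpa [sub_eq_add_neg] using Real.multipliable_one_add_of_summable h

/-- `S_c(X) = ∑_{X/2 < n ≤ X} μ²([n^c]) μ²([n^c] + 1)`, the sum running over the positive
integers `n` with `X / 2 < n ≤ X`. -/
noncomputable def S (c X : ℝ) : ℝ :=
  ∑ n ∈ (Finset.Icc 1 ⌊X⌋₊).filter (fun n : ℕ => X / 2 < (n : ℝ)),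
    (ArithmeticFunction.moebius ⌊(n : ℝ) ^ c⌋₊ : ℝ) ^ 2 *
      (ArithmeticFunction.moebius (⌊(n : ℝ) ^ c⌋₊ + 1) : ℝ) ^ 2

end ConsecutiveSquarefree

/-! Put γ = 1/c and D = X^((2c-1)/8). For m = [n^c], expand μ²(m) and μ²(m+1) by μ²(m) = ∑_{d² ∣ m}
μ(d) and keep only d, t ≤ D. Since n ↦ [n^c] is injective, the discarded terms cost at most a
divisor bound X^ε times the number of pairs (m, d) with m ≪ X^c, d > D, d² ∣ m. That is X^(c+ε)/D =
X^((6c+1)/8+ε) (`exists_abs_S_sub_truncated_le`).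

For coprime d, t the conditions d² ∣ m and t² ∣ m+1 are one residue class modulo q = e², e = dt ≤
D², so [n^c] has to be equidistributed in such classes (`exists_abs_residueCount_sub_le`). Since
[n^c] = m exactly when m^γ ≤ n < (m+1)^γ, the count is, up to O(1), ∑_k (⌈(qk+a+1)^γ⌉ - ⌈(qk+a)^γ⌉).
This equals X/(2q) + O(1) plus a difference of two sawtooth sums along -(qk+b)^γ. The second
differences of that sequence have order e⁴ X^(1-2c) = R₀^(-8), where R₀ = D/√e.

The sawtooth sums are bounded without exponential sums (`abs_sum_fract_sub_half_le`). The range is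
cut greedily into blocks of length r on which the sequence is nearly a progression of slope a/r; a
complete residue system cancels, so each block costs O(1). Short blocks are rare, because an
increasing slope spends little time near fractions of small denominator. For K terms this gives K/R₀
+ R₀⁶ ≪ X^c/(D e^(3/2)), where the second term is absorbed because D⁷ ≤ X^c, that is, c ≤ 7/6.

The sum of (dt)^(-3/2) converges, so the total is O(X^c/D), matching the truncation error. The
densities add up to σ by an Euler product (`tsum_pairDensity`). Infinitude follows since (6c+1)/8 <
1 and σ > 0. -/

namespace ConsecutiveSquarefree

/-! ### Sawtooth sums along sequences with small second differences -/

/-- A complete residue system shifts the sum of fractional parts by at most one. -/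
theorem sum_fract_add_div_mem_Icc (x : ℝ) (a : ℤ) {r : ℕ} (hr : 0 < r) (ha : IsCoprime a (r : ℤ)) :
    ∑ j ∈ Finset.range r, Int.fract (x + a * j / r) ∈
      Set.Icc (((r : ℝ) - 1) / 2) (((r : ℝ) + 1) / 2) := by
  have hr' : (0 : ℝ) < r := by exact_mod_cast hr
  have hrz : (0 : ℤ) < r := by exact_mod_cast hr
  set N : ℤ := ⌊x * r⌋ with hN
  set θ : ℝ := Int.fract (x * r) with hθ
  have hx : x * r = N + θ := (Int.floor_add_fract _).symm
  have h0 : 0 ≤ θ := Int.fract_nonneg _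
  have h1 : θ < 1 := Int.fract_lt_one _
  -- With x r = N + θ, only the residue of N + a j modulo r matters, and these residues permute 0,
  -- …, r-1. The sum is therefore exactly (r-1)/2 + θ.
  have key : ∀ j : ℕ, Int.fract (x + a * j / r) = ((((N + a * j) % r).toNat : ℕ) + θ) / r := by
    intro j
    have hnn := Int.emod_nonneg (N + a * j) hrz.ne'
    have hlt := Int.emod_lt_of_pos (N + a * j) hrz
    have hcast : ((((N + a * j) % r).toNat : ℕ) : ℝ) = (((N + a * j) % r : ℤ) : ℝ) := by
      rw [← Int.cast_natCast, Int.toNat_of_nonneg hnn]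
    rw [hcast, Int.fract_eq_iff]
    have hnn' : (0 : ℝ) ≤ ((N + a * j) % r : ℤ) := by exact_mod_cast hnn
    have hlt' : (((N + a * j) % r : ℤ) : ℝ) ≤ r - 1 := by
      have : (N + a * j) % r ≤ (r : ℤ) - 1 := by omega
      exact_mod_cast this
    refine ⟨by positivity, by rw [div_lt_one hr']; linarith, (N + a * j) / r, ?_⟩
    have h3 : (((N + a * j) % r : ℤ) : ℝ) = N + a * j - r * ((N + a * j) / r : ℤ) := by
      have := Int.emod_add_mul_ediv (N + a * j) r
      have h4 : (((N + a * j) % r : ℤ) : ℝ) + r * ((N + a * j) / r : ℤ) = N + a * j := by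
        exact_mod_cast this
      linarith
    rw [h3]
    field_simp
    linarith
  have hbij : ∑ j ∈ Finset.range r, ((((N + a * j) % r).toNat : ℕ) : ℝ) =
      ∑ i ∈ Finset.range r, (i : ℝ) := by
    have hmaps : ∀ j ∈ Finset.range r, ((N + a * j) % r).toNat ∈ Finset.range r := by
      intro j _
      have hnn := Int.emod_nonneg (N + a * j) hrz.ne'
      have hlt := Int.emod_lt_of_pos (N + a * j) hrz
      rw [Finset.mem_range]; omega
    have hinj : Set.InjOn (fun j : ℕ => ((N + a * j) % r).toNat) (Finset.range r) := by
      intro i hi j hj hij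
      simp only [Finset.coe_range, Set.mem_Iio] at hi hj
      have hnn := Int.emod_nonneg (N + a * i) hrz.ne'
      have hnn' := Int.emod_nonneg (N + a * j) hrz.ne'
      have h5 : (N + a * i) % r = (N + a * j) % r := by
        simp only at hij; omega
      have h6 : (r : ℤ) ∣ a * (i - j) := by
        have := Int.ModEq.dvd (show (N + a * j) ≡ (N + a * i) [ZMOD r] from h5.symm)
        convert this using 1; ring
      have h7 : (r : ℤ) ∣ (i - j : ℤ) := ha.symm.dvd_of_dvd_mul_left h6
      obtain ⟨t, ht⟩ := h7
      have : t = 0 := by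
        by_contra hne
        rcases lt_or_gt_of_ne hne with h | h <;> nlinarith
      subst this; omega
    have himg : (Finset.range r).image (fun j : ℕ => ((N + a * j) % r).toNat) = Finset.range r := by
      apply Finset.eq_of_subset_of_card_le
      · intro y hy
        obtain ⟨j, hj, rfl⟩ := Finset.mem_image.1 hy
        exact hmaps j hj
      · rw [Finset.card_image_of_injOn hinj]
    conv_rhs => rw [← himg]
    rw [Finset.sum_image hinj]
  have hgauss : ∑ i ∈ Finset.range r, (i : ℝ) = r * (r - 1) / 2 := by
    have h8 := Finset.sum_range_id_mul_two r
    have h9 := congrArg (Nat.cast (R := ℝ)) h8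
    rw [Nat.cast_mul, Nat.cast_mul, Nat.cast_sub hr, Nat.cast_sum] at h9
    push_cast at h9; linarith
  have : ∑ j ∈ Finset.range r, Int.fract (x + a * j / r) = (r - 1) / 2 + θ := by
    rw [Finset.sum_congr rfl (fun j _ => key j), ← Finset.sum_div, Finset.sum_add_distrib, hbij,
      hgauss]
    simp only [Finset.sum_const, Finset.card_range, nsmul_eq_mul]
    field_simp
  rw [this]
  constructor <;> linarith

/-- The points y j lie between the progressions started at x - δ and x + δ. Monotonicity of the
floor compares fractional parts with a loss of 2δ per term, and jumps do no harm because the bound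
for a progression is uniform in its starting point. -/
theorem abs_sum_fract_sub_half_le_of_near {y : ℕ → ℝ} {x δ : ℝ} {a : ℤ} {r : ℕ} (hr : 0 < r)
    (ha : IsCoprime a (r : ℤ)) (hy : ∀ j < r, |y j - (x + a * j / r)| ≤ δ) :
    |∑ j ∈ Finset.range r, (Int.fract (y j) - 1 / 2)| ≤ 2 * δ * r + 1 := by
  have hl := (sum_fract_add_div_mem_Icc (x + δ) a hr ha).1
  have hu := (sum_fract_add_div_mem_Icc (x - δ) a hr ha).2
  have h1 : ∑ j ∈ Finset.range r, Int.fract (y j) ≤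
      ∑ j ∈ Finset.range r, (Int.fract (x - δ + a * j / r) + 2 * δ) := by
    refine Finset.sum_le_sum fun j hj => ?_
    have := abs_le.1 (hy j (Finset.mem_range.1 hj))
    have hle : x - δ + a * j / r ≤ y j := by linarith
    have hf : ((⌊x - δ + a * j / r⌋ : ℤ) : ℝ) ≤ ⌊y j⌋ := Int.cast_le.2 (Int.floor_mono hle)
    rw [← Int.self_sub_floor, ← Int.self_sub_floor]
    linarith
  have h2 : ∑ j ∈ Finset.range r, (Int.fract (x + δ + a * j / r) - 2 * δ) ≤
      ∑ j ∈ Finset.range r, Int.fract (y j) := by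
    refine Finset.sum_le_sum fun j hj => ?_
    have := abs_le.1 (hy j (Finset.mem_range.1 hj))
    have hle : y j ≤ x + δ + a * j / r := by linarith
    have hf : ((⌊y j⌋ : ℤ) : ℝ) ≤ ⌊x + δ + a * j / r⌋ := Int.cast_le.2 (Int.floor_mono hle)
    rw [← Int.self_sub_floor, ← Int.self_sub_floor]
    linarith
  simp only [Finset.sum_add_distrib, Finset.sum_sub_distrib, Finset.sum_const, Finset.card_range,
    nsmul_eq_mul] at h1 h2 ⊢
  rw [abs_le]
  constructor <;> linarith

theorem abs_sum_fract_sub_half_le_card (y : ℕ → ℝ) (s : Finset ℕ) :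
    |∑ j ∈ s, (Int.fract (y j) - 1 / 2)| ≤ s.card := by
  refine (Finset.abs_sum_le_sum_abs _ _).trans ?_
  refine (Finset.sum_le_card_nsmul _ _ 1 fun j _ => ?_).trans (by simp)
  have h0 := Int.fract_nonneg (y j)
  have h1 := Int.fract_lt_one (y j)
  rw [abs_le]; constructor <;> linarith

/-- Points whose first difference lies within `1 / (r R)` of a fraction with denominator `r`. -/
noncomputable def nearRational (f : ℕ → ℝ) (R r K : ℕ) : Finset ℕ :=
  open Classical in
  (Finset.range K).filter fun k => ∃ a : ℤ, |r * (f (k + 1) - f k) - a| ≤ 1 / (R : ℝ)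

theorem abs_sub_sub_mul_diff_le {f : ℕ → ℝ} {M : ℝ} {K : ℕ}
    (h0 : ∀ k < K, 0 ≤ f (k + 2) - 2 * f (k + 1) + f k)
    (h1 : ∀ k < K, f (k + 2) - 2 * f (k + 1) + f k ≤ M) (k j : ℕ) (hkj : k + j ≤ K) :
    |f (k + j) - f k - j * (f (k + 1) - f k)| ≤ M * j ^ 2 := by
  have hd : ∀ i, k + i ≤ K → 0 ≤ f (k + i + 1) - f (k + i) - (f (k + 1) - f k) ∧
      f (k + i + 1) - f (k + i) - (f (k + 1) - f k) ≤ M * i := by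
    intro i
    induction i with
    | zero => simp
    | succ i ih =>
      intro hi
      obtain ⟨a, b⟩ := ih (by omega)
      have c := h0 (k + i) (by omega)
      have d := h1 (k + i) (by omega)
      rw [show k + (i + 1) + 1 = k + i + 2 by ring, show k + (i + 1) = k + i + 1 by ring]
      push_cast
      constructor <;> linarith
  induction j with
  | zero => simp
  | succ j ih =>
    obtain ⟨a, b⟩ := hd j (by omega)
    have := abs_le.1 (ih (by omega))
    have hM : 0 ≤ M * j := a.trans b
    rw [show k + (j + 1) = k + j + 1 by ring]
    have hM' : 0 ≤ M := (h0 k (by omega)).trans (h1 k (by omega))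
    push_cast
    rw [abs_le]
    constructor <;> nlinarith

/-- Greedy block decomposition. A Dirichlet approximation a/r to the slope at k gives a block of r
terms that costs 1 beyond its approximation error. If r ≥ R₀ that 1 is spread over the block as
r/R₀; otherwise k is bad and is charged for it. The final R pays for a last incomplete block. -/
theorem abs_sum_fract_sub_half_le_add_card_bad {f : ℕ → ℝ} {M : ℝ} {K R R₀ : ℕ} (hR : 0 < R)
    (hR₀ : 0 < R₀)
    (h0 : ∀ k < K, 0 ≤ f (k + 2) - 2 * f (k + 1) + f k)
    (h1 : ∀ k < K, f (k + 2) - 2 * f (k + 1) + f k ≤ M) (B : Finset ℕ)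
    (hB : ∀ r, 0 < r → r < R₀ → nearRational f R r K ⊆ B) (n : ℕ) :
    ∀ k, k + n = K → |∑ i ∈ Finset.Ico k K, (Int.fract (f i) - 1 / 2)| ≤
      (2 * (1 / R + M * R ^ 2) + 1 / R₀) * n + ((Finset.Ico k K).filter (· ∈ B)).card + R := by
  have hRr : (0 : ℝ) < R := by exact_mod_cast hR
  have hR₀r : (0 : ℝ) < R₀ := by exact_mod_cast hR₀
  induction n using Nat.strong_induction_on with
  | _ n ih =>
  intro k hk
  have hM' : 0 < n → 0 ≤ M := fun hn => (h0 k (by omega)).trans (h1 k (by omega))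
  by_cases hnR : n ≤ R
  · refine (abs_sum_fract_sub_half_le_card _ _).trans ?_
    rw [Nat.card_Ico, show K - k = n by omega]
    have : (n : ℝ) ≤ R := by exact_mod_cast hnR
    have h3 : 0 ≤ (2 * (1 / R + M * R ^ 2) + 1 / (R₀ : ℝ)) * n := by
      rcases Nat.eq_zero_or_pos n with rfl | hn
      · simp
      · have := hM' hn; positivity
    have h4 : (0 : ℝ) ≤ ((Finset.Ico k K).filter (· ∈ B)).card := Nat.cast_nonneg _
    linarith
  push Not at hnR
  have hM := hM' (by omega)
  obtain ⟨p, hp, hpR⟩ := Real.exists_rat_abs_sub_le_and_den_le (f (k + 1) - f k) hR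
  set r := p.den with hr
  have hr0 : 0 < r := p.den_pos
  have hr0r : (0 : ℝ) < r := by exact_mod_cast hr0
  have hrR : (r : ℝ) ≤ R := by exact_mod_cast hpR
  have hcop : IsCoprime p.num (r : ℤ) := by
    rw [Int.isCoprime_iff_gcd_eq_one]
    exact p.reduced
  have hpr : (p : ℝ) = p.num / r := by
    conv_lhs => rw [← Rat.num_div_den p]
    push_cast; rfl
  rw [hpr] at hp
  set β := f (k + 1) - f k with hβ
  have hblock : |∑ j ∈ Finset.range r, (Int.fract (f (k + j)) - 1 / 2)| ≤
      2 * (1 / R + M * R ^ 2) * r + 1 := by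
    refine abs_sum_fract_sub_half_le_of_near (x := f k) (a := p.num) hr0 hcop fun j hj => ?_
    have e1 := abs_sub_sub_mul_diff_le h0 h1 k j (by omega)
    have hjr : (j : ℝ) ≤ r := by exact_mod_cast hj.le
    have e2 : |j * β - p.num * j / r| ≤ 1 / R := by
      have : j * β - p.num * j / r = j * (β - p.num / r) := by ring
      rw [this, abs_mul, abs_of_nonneg (Nat.cast_nonneg j)]
      calc (j : ℝ) * |β - p.num / r| ≤ r * (1 / ((R + 1) * r)) := by gcongr
        _ = 1 / (R + 1) := by field_simp
        _ ≤ 1 / R := by gcongr; linarith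
    have e3 : M * (j : ℝ) ^ 2 ≤ M * R ^ 2 := by gcongr; linarith
    have e4 : f (k + j) - (f k + p.num * j / r) =
      (f (k + j) - f k - j * β) + (j * β - p.num * j / r) := by ring
    rw [e4]
    refine (abs_add_le _ _).trans ?_
    linarith
  have hsplit : ∑ i ∈ Finset.Ico k K, (Int.fract (f i) - 1 / 2) =
      ∑ j ∈ Finset.range r, (Int.fract (f (k + j)) - 1 / 2) +
        ∑ i ∈ Finset.Ico (k + r) K, (Int.fract (f i) - 1 / 2) := by
    rw [← Finset.sum_Ico_consecutive _ (show k ≤ k + r by omega) (show k + r ≤ K by omega)]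
    congr 1
    rw [Finset.sum_Ico_eq_sum_range]
    simp
  have hih := ih (n - r) (by omega) (k + r) (by omega)
  rw [Nat.cast_sub (by omega)] at hih
  have hcost : (1 : ℝ) + ((Finset.Ico (k + r) K).filter (· ∈ B)).card ≤
      1 / R₀ * r + ((Finset.Ico k K).filter (· ∈ B)).card := by
    have hsub : (Finset.Ico (k + r) K).filter (· ∈ B) ⊆ (Finset.Ico k K).filter (· ∈ B) :=
      Finset.filter_subset_filter _ (Finset.Ico_subset_Ico (by omega) le_rfl)
    by_cases hrR₀ : r < R₀
    · have hkB : k ∈ B := by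
        refine hB r hr0 hrR₀ ?_
        simp only [nearRational, Finset.mem_filter, Finset.mem_range]
        refine ⟨by omega, p.num, ?_⟩
        have : r * β - p.num = r * (β - p.num / r) := by field_simp
        rw [this, abs_mul, abs_of_pos hr0r]
        calc (r : ℝ) * |β - p.num / r| ≤ r * (1 / ((R + 1) * r)) := by gcongr
          _ = 1 / (R + 1) := by field_simp
          _ ≤ 1 / R := by gcongr; linarith
      have hlt : ((Finset.Ico (k + r) K).filter (· ∈ B)).card <
          ((Finset.Ico k K).filter (· ∈ B)).card := by
        refine Finset.card_lt_card ⟨hsub, fun h => ?_⟩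
        have := h (Finset.mem_filter.2 ⟨Finset.mem_Ico.2 ⟨le_rfl, by omega⟩, hkB⟩)
        simp only [Finset.mem_filter, Finset.mem_Ico] at this
        omega
      have hlt' : (1 : ℝ) + ((Finset.Ico (k + r) K).filter (· ∈ B)).card ≤
          ((Finset.Ico k K).filter (· ∈ B)).card := by
        exact_mod_cast (by omega : 1 + _ ≤ _)
      have : 0 ≤ 1 / (R₀ : ℝ) * r := by positivity
      linarith
    · push Not at hrR₀
      have h5 : (1 : ℝ) ≤ 1 / R₀ * r := by
        rw [one_div, inv_mul_eq_div, one_le_div hR₀r]; exact_mod_cast hrR₀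
      have h6 : (((Finset.Ico (k + r) K).filter (· ∈ B)).card : ℝ) ≤
          ((Finset.Ico k K).filter (· ∈ B)).card := by
        exact_mod_cast Finset.card_le_card hsub
      linarith
  rw [hsplit]
  refine (abs_add_le _ _).trans ?_
  nlinarith

theorem diff_sub_diff_mem_Icc {f : ℕ → ℝ} {lam M : ℝ} {K : ℕ}
    (h0 : ∀ k < K, lam ≤ f (k + 2) - 2 * f (k + 1) + f k)
    (h1 : ∀ k < K, f (k + 2) - 2 * f (k + 1) + f k ≤ M) (k j : ℕ) (hkj : k + j ≤ K) :
    (f (k + j + 1) - f (k + j)) - (f (k + 1) - f k) ∈ Set.Icc (lam * j) (M * j) := by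
  induction j with
  | zero => simp
  | succ j ih =>
    obtain ⟨a, b⟩ := ih (by omega)
    have c := h0 (k + j) (by omega)
    have d := h1 (k + j) (by omega)
    rw [show k + (j + 1) + 1 = k + j + 2 by ring, show k + (j + 1) = k + j + 1 by ring]
    push_cast
    constructor <;> linarith

/-- The sequence r (f (k+1) - f k) increases by between r lam and r M at each step. Over K steps it
meets at most r M K + 2 nearest integers, and it stays in the window of width 2/R around each for at
most 2/(R r lam) + 1 steps. -/
theorem card_nearRational_le {f : ℕ → ℝ} {lam M : ℝ} {K R r : ℕ} (hlam : 0 < lam)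
    (hM : 0 ≤ M) (hR : 0 < R) (hr : 0 < r)
    (h0 : ∀ k < K, lam ≤ f (k + 2) - 2 * f (k + 1) + f k)
    (h1 : ∀ k < K, f (k + 2) - 2 * f (k + 1) + f k ≤ M) :
    ((nearRational f R r K).card : ℝ) ≤ (r * M * K + 2) * (2 / (R * r * lam) + 1) := by
  classical
  have hRr : (0 : ℝ) < R := by exact_mod_cast hR
  have hrr : (0 : ℝ) < r := by exact_mod_cast hr
  set s : ℕ → ℝ := fun k => r * (f (k + 1) - f k) with hs
  have hdiff : ∀ k j, k + j ≤ K → s (k + j) - s k ∈ Set.Icc (r * lam * j) (r * M * j) := by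
    intro k j hkj
    obtain ⟨a, b⟩ := diff_sub_diff_mem_Icc h0 h1 k j hkj
    have e : s (k + j) - s k = r * ((f (k + j + 1) - f (k + j)) - (f (k + 1) - f k)) := by
      simp only [hs]; ring
    rw [e]
    constructor <;> nlinarith
  have hnear : ∀ k ∈ nearRational f R r K, k < K ∧ |s k - round (s k)| ≤ 1 / R := by
    intro k hk
    simp only [nearRational, Finset.mem_filter, Finset.mem_range] at hk
    obtain ⟨hkK, a, ha⟩ := hk
    exact ⟨hkK, (round_le (s k) a).trans ha⟩
  set n : ℕ := ⌊2 / (R * r * lam)⌋₊ + 1 with hn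
  have hfib : ∀ a ∈ (nearRational f R r K).image (fun k => round (s k)),
      ((nearRational f R r K).filter (fun k => round (s k) = a)).card ≤ n := by
    intro a ha
    obtain ⟨k₁, hk₁, hk₁a⟩ := Finset.mem_image.1 ha
    have hne : ((nearRational f R r K).filter (fun k => round (s k) = a)).Nonempty :=
      ⟨k₁, Finset.mem_filter.2 ⟨hk₁, hk₁a⟩⟩
    set k₀ := ((nearRational f R r K).filter (fun k => round (s k) = a)).min' hne with hk₀
    have hk₀m := Finset.min'_mem _ hne
    rw [← hk₀, Finset.mem_filter] at hk₀m
    have hsub : (nearRational f R r K).filter (fun k => round (s k) = a) ⊆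
        Finset.Ico k₀ (k₀ + n) := by
      intro k hk
      have hle : k₀ ≤ k := Finset.min'_le _ _ hk
      rw [Finset.mem_filter] at hk
      obtain ⟨hkK, hka⟩ := hnear k hk.1
      obtain ⟨-, hk₀a⟩ := hnear k₀ hk₀m.1
      rw [hk.2] at hka
      rw [hk₀m.2] at hk₀a
      obtain ⟨j, rfl⟩ := Nat.exists_eq_add_of_le hle
      have hd := (hdiff k₀ j hkK.le).1
      have hj : (j : ℝ) ≤ 2 / (R * r * lam) := by
        rw [le_div_iff₀ (by positivity)]
        have e1 := abs_le.1 hka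
        have e2 := abs_le.1 hk₀a
        have e3 : r * lam * j ≤ 2 / R := by
          have : 2 / (R : ℝ) = 1 / R + 1 / R := by ring
          linarith
        rw [le_div_iff₀ hRr] at e3
        linarith
      have := Nat.le_floor hj
      rw [Finset.mem_Ico]; omega
    exact (Finset.card_le_card hsub).trans (by simp)
  have himg : (((nearRational f R r K).image (fun k => round (s k))).card : ℝ) ≤ r * M * K + 2 := by
    have hsub : (nearRational f R r K).image (fun k => round (s k)) ⊆
        Finset.Icc ⌈s 0 - 1 / 2⌉ ⌊s 0 + r * M * K + 1 / 2⌋ := by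
      intro a ha
      obtain ⟨k, hk, rfl⟩ := Finset.mem_image.1 ha
      have hkK := (hnear k hk).1
      obtain ⟨d1, d2⟩ := hdiff 0 k (by omega)
      rw [zero_add] at d1 d2
      have d3 : (0 : ℝ) ≤ r * lam * k := by positivity
      have d4 : r * M * k ≤ r * M * K := by gcongr
      have := abs_le.1 (abs_sub_round (s k))
      rw [Finset.mem_Icc]
      exact ⟨Int.ceil_le.2 (by linarith), Int.le_floor.2 (by linarith)⟩
    have hc := Finset.card_le_card hsub
    rw [Int.card_Icc] at hc
    have e1 := Int.floor_le (s 0 + r * M * K + 1 / 2)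
    have e2 := Int.le_ceil (s 0 - 1 / 2)
    have e0 : (0 : ℝ) ≤ r * M * K := by positivity
    have e3 : (((⌊s 0 + r * M * K + 1 / 2⌋ + 1 - ⌈s 0 - 1 / 2⌉).toNat : ℤ) : ℝ) ≤
        r * M * K + 2 := by
      rcases le_total 0 (⌊s 0 + r * M * K + 1 / 2⌋ + 1 - ⌈s 0 - 1 / 2⌉) with h | h
      · rw [Int.toNat_of_nonneg h]; push_cast; linarith
      · rw [Int.toNat_of_nonpos h]; push_cast; linarith
    refine le_trans ?_ e3
    exact_mod_cast hc
  have hcard := Finset.card_le_mul_card_image _ n hfib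
  have hnle : (n : ℝ) ≤ 2 / (R * r * lam) + 1 := by
    rw [hn]; push_cast
    have := Nat.floor_le (show 0 ≤ 2 / (R * r * lam) by positivity)
    linarith
  calc ((nearRational f R r K).card : ℝ)
      ≤ n * ((nearRational f R r K).image (fun k => round (s k))).card := by exact_mod_cast hcard
    _ ≤ (2 / (R * r * lam) + 1) * (r * M * K + 2) := by gcongr
    _ = _ := by ring

/-- An elementary bound for sums of the sawtooth function along a sequence with second
differences of a fixed order of magnitude. -/
theorem abs_sum_fract_sub_half_le {f : ℕ → ℝ} {lam M A : ℝ} {K R₀ : ℕ} (hlam : 0 < lam)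
    (hR₀ : 0 < R₀) (hK : 0 < K)
    (h0 : ∀ k < K, lam ≤ f (k + 2) - 2 * f (k + 1) + f k)
    (h1 : ∀ k < K, f (k + 2) - 2 * f (k + 1) + f k ≤ M)
    (hMl : M ≤ A * lam) (hMR : M * R₀ ^ 8 ≤ A) (hlR : 1 ≤ A * (lam * R₀ ^ 8)) :
    |∑ k ∈ Finset.range K, (Int.fract (f k) - 1 / 2)| ≤
      (3 + 5 * A) * (K / R₀) + (3 + 4 * A) * R₀ ^ 6 := by
  classical
  have hR₀r : (1 : ℝ) ≤ R₀ := by exact_mod_cast hR₀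
  have hR₀p : (0 : ℝ) < R₀ := by linarith
  have hM : lam ≤ M := (h0 0 hK).trans (h1 0 hK)
  have hM0 : 0 < M := hlam.trans_le hM
  have hA : 0 < A := by
    have : 0 < M * (R₀ : ℝ) ^ 8 := by positivity
    linarith
  set B : Finset ℕ := (Finset.Ico 1 R₀).biUnion fun r => nearRational f (R₀ ^ 3) r K with hB
  -- The choice R = R₀³ keeps the curvature error M R² = M R₀⁶ below A/R₀. It also makes the share
  -- 2AK/R of bad indices, summed over fewer than R₀ denominators, at most 2AK/R₀.
  have hgreedy := abs_sum_fract_sub_half_le_add_card_bad (f := f) (R := R₀ ^ 3) (R₀ := R₀)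
    (by positivity) hR₀ (fun k hk => hlam.le.trans (h0 k hk)) h1 B (fun r hr hrR =>
      Finset.subset_biUnion_of_mem (fun r => nearRational f (R₀ ^ 3) r K)
        (Finset.mem_Ico.2 ⟨hr, hrR⟩)) K 0 (by simp)
  have hbad : (((Finset.Ico 0 K).filter (· ∈ B)).card : ℝ) ≤
      R₀ * (2 * A * K / R₀ ^ 3 + M * R₀ * K + 4 / (R₀ ^ 3 * lam) + 2) := by
    have e1 : ((Finset.Ico 0 K).filter (· ∈ B)).card ≤ B.card := by
      refine Finset.card_le_card fun k hk => ?_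
      exact (Finset.mem_filter.1 hk).2
    have e2 : B.card ≤ ∑ r ∈ Finset.Ico 1 R₀, (nearRational f (R₀ ^ 3) r K).card :=
      Finset.card_biUnion_le
    have e3 : ∀ r ∈ Finset.Ico 1 R₀, ((nearRational f (R₀ ^ 3) r K).card : ℝ) ≤
        2 * A * K / R₀ ^ 3 + M * R₀ * K + 4 / (R₀ ^ 3 * lam) + 2 := by
      intro r hr
      rw [Finset.mem_Ico] at hr
      have hr1 : (1 : ℝ) ≤ r := by exact_mod_cast hr.1
      have hrR : (r : ℝ) ≤ R₀ := by exact_mod_cast hr.2.le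
      refine (card_nearRational_le (R := R₀ ^ 3) hlam hM0.le (by positivity) hr.1 h0 h1).trans ?_
      push_cast
      have f1 : (r * M * K + 2) * (2 / ((R₀ : ℝ) ^ 3 * r * lam) + 1) =
          2 * (M / lam) * K / R₀ ^ 3 + M * r * K + 4 / (R₀ ^ 3 * (r * lam)) + 2 := by
        field_simp; ring
      rw [f1]
      have f2 : M / lam ≤ A := by rwa [div_le_iff₀ hlam]
      have f3 : lam ≤ r * lam := by nlinarith
      gcongr
    calc (((Finset.Ico 0 K).filter (· ∈ B)).card : ℝ)
        ≤ ∑ r ∈ Finset.Ico 1 R₀, ((nearRational f (R₀ ^ 3) r K).card : ℝ) := by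
          exact_mod_cast e1.trans e2
      _ ≤ _ := (Finset.sum_le_card_nsmul _ _ _ e3)
      _ ≤ _ := by
        rw [nsmul_eq_mul, Nat.card_Ico]
        gcongr
        omega
  rw [← Finset.range_eq_Ico] at hgreedy
  rw [← Finset.range_eq_Ico] at hbad
  push_cast at hgreedy
  refine hgreedy.trans ?_
  have g1 : (1 : ℝ) / R₀ ^ 3 ≤ 1 / R₀ := by
    gcongr; exact le_self_pow₀ hR₀r (by norm_num)
  have g2 : M * ((R₀ : ℝ) ^ 3) ^ 2 ≤ A / R₀ := by
    rw [le_div_iff₀ hR₀p]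
    refine le_trans ?_ hMR
    have : (R₀ : ℝ) ^ 7 ≤ R₀ ^ 8 := pow_le_pow_right₀ hR₀r (by norm_num)
    calc M * ((R₀ : ℝ) ^ 3) ^ 2 * R₀ = M * R₀ ^ 7 := by ring
      _ ≤ _ := by gcongr
  have g3 : (R₀ : ℝ) * (2 * A * K / R₀ ^ 3) ≤ 2 * A * (K / R₀) := by
    have : (R₀ : ℝ) * (2 * A * K / R₀ ^ 3) = 2 * A * (K / R₀ ^ 2) := by field_simp
    rw [this]
    gcongr; exact le_self_pow₀ hR₀r (by norm_num)
  have g4 : (R₀ : ℝ) * (M * R₀ * K) ≤ A * (K / R₀) := by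
    have h8 : (R₀ : ℝ) ^ 3 ≤ R₀ ^ 8 := pow_le_pow_right₀ hR₀r (by norm_num)
    have : M * R₀ ^ 3 ≤ A := le_trans (by gcongr) hMR
    have e : (R₀ : ℝ) * (M * R₀ * K) = M * R₀ ^ 3 * (K / R₀) := by field_simp
    rw [e]; gcongr
  have g5 : (R₀ : ℝ) * (4 / (R₀ ^ 3 * lam)) ≤ 4 * A * R₀ ^ 6 := by
    have e : (R₀ : ℝ) * (4 / (R₀ ^ 3 * lam)) = 4 / (R₀ ^ 2 * lam) := by field_simp
    rw [e, div_le_iff₀ (by positivity)]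
    calc (4 : ℝ) = 4 * 1 := by ring
      _ ≤ 4 * (A * (lam * R₀ ^ 8)) := by gcongr
      _ = _ := by ring
  have g6 : (R₀ : ℝ) ≤ R₀ ^ 6 := le_self_pow₀ hR₀r (by norm_num)
  have g7 : (R₀ : ℝ) ^ 3 ≤ R₀ ^ 6 := pow_le_pow_right₀ hR₀r (by norm_num)
  have g8 : (2 * (1 / (R₀ : ℝ) ^ 3 + M * ((R₀ : ℝ) ^ 3) ^ 2) + 1 / R₀) * K ≤
      (2 * (1 / R₀ + A / R₀) + 1 / R₀) * K := by gcongr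
  have g9 : (2 * (1 / R₀ + A / R₀) + 1 / R₀) * K = (3 + 2 * A) * ((K : ℝ) / R₀) := by
    field_simp; ring
  nlinarith

/-! ### The sawtooth along γ-th powers of an arithmetic progression -/

/-- Two applications of the mean value theorem, to z^γ - (z+q)^γ and then to z^(γ-1), give exactly
γ(1-γ) q² η^(γ-2) with x ≤ η ≤ x + 2q. -/
theorem second_difference_neg_rpow_mem_Icc {γ q x : ℝ} (h0 : 0 < γ) (h1 : γ < 1) (hq : 0 < q)
    (hx : 0 < x) :
    -(x + 2 * q) ^ γ - 2 * -(x + q) ^ γ + -x ^ γ ∈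
      Set.Icc (γ * (1 - γ) * q ^ 2 * (x + 2 * q) ^ (γ - 2)) (γ * (1 - γ) * q ^ 2 * x ^ (γ - 2)) := by
  have hd : ∀ p : ℝ, ∀ y : ℝ, 0 < y → HasDerivAt (fun z : ℝ => z ^ p) (p * y ^ (p - 1)) y :=
    fun p y hy => Real.hasDerivAt_rpow_const (Or.inl hy.ne')
  have hds : ∀ y : ℝ, 0 < y →
      HasDerivAt (fun z : ℝ => z ^ γ - (z + q) ^ γ) (γ * y ^ (γ - 1) - γ * (y + q) ^ (γ - 1)) y :=
    fun y hy => (hd γ y hy).sub ((hd γ (y + q) (by linarith)).comp_add_const y q)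
  obtain ⟨ξ, hξ, hξe⟩ := exists_hasDerivAt_eq_slope (fun z : ℝ => z ^ γ - (z + q) ^ γ)
    (fun y => γ * y ^ (γ - 1) - γ * (y + q) ^ (γ - 1)) (show x < x + q by linarith)
    (fun y hy => (hds y (hx.trans_le hy.1)).continuousAt.continuousWithinAt)
    (fun y hy => hds y (hx.trans hy.1))
  have hξ0 : 0 < ξ := hx.trans hξ.1
  obtain ⟨η, hη, hηe⟩ := exists_hasDerivAt_eq_slope (fun z : ℝ => z ^ (γ - 1))
    (fun y => (γ - 1) * y ^ (γ - 1 - 1)) (show ξ < ξ + q by linarith)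
    (fun y hy => (hd _ y (hξ0.trans_le hy.1)).continuousAt.continuousWithinAt)
    (fun y hy => hd _ y (hξ0.trans hy.1))
  have hη0 : 0 < η := hξ0.trans hη.1
  rw [eq_div_iff (by linarith)] at hξe hηe
  have key : -(x + 2 * q) ^ γ - 2 * -(x + q) ^ γ + -x ^ γ = γ * (1 - γ) * q ^ 2 * η ^ (γ - 2) := by
    have e1 : γ - 1 - 1 = γ - 2 := by ring
    rw [e1] at hηe
    have e2 : x + q + q = x + 2 * q := by ring
    rw [e2] at hξe
    linear_combination (-1 : ℝ) * hξe + γ * q * hηe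
  rw [key]
  have hc : 0 ≤ γ * (1 - γ) * q ^ 2 := by
    have : 0 < 1 - γ := by linarith
    positivity
  have hη2 : η ≤ x + 2 * q := by linarith [hη.2, hξ.2]
  have hη1 : x ≤ η := by linarith [hη.1, hξ.1]
  constructor
  · exact mul_le_mul_of_nonneg_left
      (Real.rpow_le_rpow_of_nonpos hη0 hη2 (by linarith)) hc
  · exact mul_le_mul_of_nonneg_left
      (Real.rpow_le_rpow_of_nonpos hx hη1 (by linarith)) hc

/-- Here Y plays the role of X^c. The value b = e² is allowed because the upper endpoint a + 1 of a
class modulo e² can reach it. -/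
theorem exists_abs_sum_fract_neg_rpow_le {γ : ℝ} (hγ0 : 0 < γ) (hγ1 : γ < 1) :
    ∃ C : ℝ, 0 < C ∧ ∀ (Y D : ℝ) (e b u v : ℕ), 0 < Y → 1 ≤ D → Y ^ (γ - 2) = (D ^ 8)⁻¹ →
      D ^ 7 ≤ Y → 0 < e → (e : ℝ) ≤ D ^ 2 → b ≤ e ^ 2 → u < v → Y / 8 ≤ (e : ℝ) ^ 2 * u →
      (e : ℝ) ^ 2 * (v + 3) ≤ 2 * Y →
      |∑ k ∈ Finset.Ico u v, (Int.fract (-((e : ℝ) ^ 2 * k + b) ^ γ) - 1 / 2)| ≤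
        C * (Y / (D * √(e : ℝ) ^ 3)) := by
  set κ := γ * (1 - γ) with hκ
  have hκ0 : 0 < κ := mul_pos hγ0 (by linarith)
  have hκ1 : κ ≤ 1 := by nlinarith
  -- 2^14 = 64 · 256: the factor 64 bounds (Y/8)^(γ-2) against Y^(γ-2), and 256 = 2⁸ comes from R₀ ≤
  -- 2D/√e. The term 4/κ inverts the lower bound κ q²/(4 D⁸) for the second differences.
  set A : ℝ := 2 ^ 14 + 4 / κ with hA
  have hA0 : 0 < A := by positivity
  refine ⟨2 * (3 + 5 * A) + 64 * (3 + 4 * A), by positivity, ?_⟩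
  intro Y D e b u v hY hD hYD hD7 he heD hb huv hu hv
  have hD0 : 0 < D := by linarith
  have he1 : (1 : ℝ) ≤ e := by exact_mod_cast he
  set s := √(e : ℝ) with hs
  have hs1 : 1 ≤ s := Real.one_le_sqrt.2 he1
  have hs2 : s ^ 2 = e := Real.sq_sqrt (by linarith)
  have hsD : s ≤ D := by
    rw [hs]; exact Real.sqrt_le_iff.2 ⟨hD0.le, heD⟩
  have hs0 : 0 < s := by linarith
  -- Since q² = s⁸, the second differences, of order q²/D⁸, have order R₀^(-8), as the sawtooth
  -- bound requires.
  set R₀ : ℕ := ⌈D / s⌉₊ with hR₀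
  have hDs : 1 ≤ D / s := by rwa [one_le_div hs0]
  have hRl : D / s ≤ R₀ := Nat.le_ceil _
  have hRu : (R₀ : ℝ) ≤ 2 * (D / s) := by
    have := (Nat.ceil_lt_add_one (show 0 ≤ D / s by positivity)).le
    rw [← hR₀] at this
    linarith
  have hR₀0 : (0 : ℝ) < R₀ := by linarith
  have hbr : (b : ℝ) ≤ (e : ℝ) ^ 2 := by exact_mod_cast hb
  set q : ℝ := (e : ℝ) ^ 2 with hq
  have hq0 : 0 < q := by positivity
  have hqs : q = s ^ 4 := by rw [hq, ← hs2]; ring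
  have hb0 : (0 : ℝ) ≤ b := Nat.cast_nonneg b
  obtain ⟨K, rfl⟩ := Nat.exists_eq_add_of_le huv.le
  have hK : 0 < K := by omega
  push_cast at hv
  set f : ℕ → ℝ := fun i => -(q * (u + i : ℕ) + b) ^ γ with hf
  have hx0 : ∀ i : ℕ, Y / 8 ≤ q * (u + i : ℕ) + b := by
    intro i; push_cast
    have : 0 ≤ q * i := by positivity
    linarith
  have hrw : ∀ i : ℕ, f (i + 2) - 2 * f (i + 1) + f i = -(q * (u + i : ℕ) + b + 2 * q) ^ γ -
      2 * -(q * (u + i : ℕ) + b + q) ^ γ + -(q * (u + i : ℕ) + b) ^ γ := by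
    intro i
    simp only [hf]
    push_cast
    ring_nf
  have hmem := fun i : ℕ => second_difference_neg_rpow_mem_Icc hγ0 hγ1 hq0
    (lt_of_lt_of_le (by positivity) (hx0 i))
  have h8 : (Y / 8) ^ (γ - 2) ≤ 64 * (D ^ 8)⁻¹ := by
    rw [Real.div_rpow hY.le (by norm_num), hYD, div_eq_mul_inv, mul_comm]
    gcongr
    rw [← Real.rpow_neg (by norm_num)]
    calc (8 : ℝ) ^ (-(γ - 2)) ≤ 8 ^ (2 : ℝ) :=
          Real.rpow_le_rpow_of_exponent_le (by norm_num) (by linarith)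
      _ = 64 := by norm_num
  have h2 : (D ^ 8)⁻¹ / 4 ≤ (2 * Y) ^ (γ - 2) := by
    rw [Real.mul_rpow (by norm_num) hY.le, hYD, div_eq_mul_inv, mul_comm]
    gcongr
    calc (4 : ℝ)⁻¹ = 2 ^ (-2 : ℝ) := by
          rw [Real.rpow_neg (by norm_num)]; norm_num
      _ ≤ 2 ^ (γ - 2) := Real.rpow_le_rpow_of_exponent_le (by norm_num) (by linarith)
  have hlow : ∀ i < K, κ * q ^ 2 * ((D ^ 8)⁻¹ / 4) ≤ f (i + 2) - 2 * f (i + 1) + f i := by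
    intro i hi
    rw [hrw]
    refine le_trans ?_ (hmem i).1
    have hi' : (i : ℝ) + 1 ≤ K := by exact_mod_cast hi
    have hle : q * (u + i : ℕ) + b + 2 * q ≤ 2 * Y := by
      push_cast
      nlinarith
    have hpos : 0 < q * (u + i : ℕ) + b + 2 * q := by positivity
    have := Real.rpow_le_rpow_of_nonpos hpos hle (show γ - 2 ≤ 0 by linarith)
    gcongr
    exact h2.trans this
  have hupp : ∀ i < K, f (i + 2) - 2 * f (i + 1) + f i ≤ κ * q ^ 2 * (64 * (D ^ 8)⁻¹) := by
    intro i hi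
    rw [hrw]
    refine (hmem i).2.trans ?_
    have := Real.rpow_le_rpow_of_nonpos (show 0 < Y / 8 by positivity) (hx0 i)
      (show γ - 2 ≤ 0 by linarith)
    gcongr
    exact this.trans h8
  have hRl8 : D ^ 8 / q ^ 2 ≤ (R₀ : ℝ) ^ 8 := by
    calc D ^ 8 / q ^ 2 = (D / s) ^ 8 := by rw [hqs, div_pow]; ring
      _ ≤ _ := by gcongr
  have hRu8 : (R₀ : ℝ) ^ 8 ≤ 256 * (D ^ 8 / q ^ 2) := by
    calc (R₀ : ℝ) ^ 8 ≤ (2 * (D / s)) ^ 8 := by gcongr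
      _ = _ := by rw [hqs, mul_pow, div_pow]; ring
  have hmain := abs_sum_fract_sub_half_le (f := f) (A := A) (R₀ := R₀)
    (lam := κ * q ^ 2 * ((D ^ 8)⁻¹ / 4)) (by positivity) (by exact_mod_cast hR₀0) hK hlow hupp
    (by
      have : κ * q ^ 2 * (64 * (D ^ 8)⁻¹) = 256 * (κ * q ^ 2 * ((D ^ 8)⁻¹ / 4)) := by ring
      rw [this]
      have : (256 : ℝ) ≤ A := by rw [hA]; have : 0 < 4 / κ := by positivity
                                 linarith
      gcongr)
    (by
      calc κ * q ^ 2 * (64 * (D ^ 8)⁻¹) * R₀ ^ 8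
          ≤ κ * q ^ 2 * (64 * (D ^ 8)⁻¹) * (256 * (D ^ 8 / q ^ 2)) := by gcongr
        _ = 2 ^ 14 * κ := by field_simp; norm_num
        _ ≤ A := by rw [hA]; have : 0 < 4 / κ := by positivity
                    linarith)
    (by
      calc (1 : ℝ) = 4 / κ * (κ * q ^ 2 * ((D ^ 8)⁻¹ / 4) * (D ^ 8 / q ^ 2)) := by field_simp
        _ ≤ A * (κ * q ^ 2 * ((D ^ 8)⁻¹ / 4) * R₀ ^ 8) := by
          gcongr
          rw [hA]; linarith)
  have hsum : ∑ k ∈ Finset.Ico u (u + K), (Int.fract (-(q * k + b) ^ γ) - 1 / 2) =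
      ∑ i ∈ Finset.range K, (Int.fract (f i) - 1 / 2) := by
    rw [Finset.sum_Ico_eq_sum_range]
    simp [hf]
  rw [hsum]
  refine hmain.trans ?_
  have hKY : (K : ℝ) ≤ 2 * Y / q := by
    rw [le_div_iff₀ hq0]
    have : 0 ≤ q * u := by positivity
    nlinarith
  have hKR : (K : ℝ) / R₀ ≤ 2 * (Y / (D * s ^ 3)) := by
    calc (K : ℝ) / R₀ ≤ (2 * Y / q) / (D / s) := by gcongr
      _ = 2 * (Y / (D * s ^ 3)) := by rw [hqs]; field_simp
  have hR6 : (R₀ : ℝ) ^ 6 ≤ 64 * (Y / (D * s ^ 3)) := by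
    calc (R₀ : ℝ) ^ 6 ≤ (2 * (D / s)) ^ 6 := by gcongr
      _ = 64 * (D ^ 7 / (D * s ^ 6)) := by rw [mul_pow, div_pow]; field_simp; norm_num
      _ ≤ 64 * (Y / (D * s ^ 3)) := by
        gcongr
        norm_num
  calc (3 + 5 * A) * ((K : ℝ) / R₀) + (3 + 4 * A) * R₀ ^ 6
      ≤ (3 + 5 * A) * (2 * (Y / (D * s ^ 3))) + (3 + 4 * A) * (64 * (Y / (D * s ^ 3))) := by gcongr
    _ = _ := by ring

/-! ### Distribution of [n^c] in residue classes -/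

theorem mem_Ico_ceil_rpow_inv_iff {c : ℝ} (hc : 0 < c) (m n : ℕ) :
    n ∈ Finset.Ico ⌈(m : ℝ) ^ c⁻¹⌉₊ ⌈((m : ℝ) + 1) ^ c⁻¹⌉₊ ↔ ⌊(n : ℝ) ^ c⌋₊ = m := by
  rw [Finset.mem_Ico, Nat.ceil_le, Nat.lt_ceil,
    Real.rpow_inv_le_iff_of_pos (by positivity) (by positivity) hc,
    Real.lt_rpow_inv_iff_of_pos (by positivity) (by positivity) hc,
    Nat.floor_eq_iff (by positivity)]

theorem add_rpow_le_rpow_add {γ : ℝ} (h0 : 0 < γ) (h1 : γ < 1) {x y : ℝ} (hx : 0 ≤ x)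
    (hy : 1 ≤ y) : (x + y) ^ γ ≤ x ^ γ + y := by
  refine (Real.rpow_add_le_add_rpow hx (by linarith) h0.le h1.le).trans ?_
  have := Real.rpow_le_rpow_of_exponent_le hy h1.le
  rw [Real.rpow_one] at this
  linarith

theorem card_Ico_ceil_rpow_le_one {γ : ℝ} (h0 : 0 < γ) (h1 : γ < 1) (m : ℕ) :
    (Finset.Ico ⌈(m : ℝ) ^ γ⌉₊ ⌈((m : ℝ) + 1) ^ γ⌉₊).card ≤ 1 := by
  rw [Nat.card_Ico]
  have h2 : ⌈((m : ℝ) + 1) ^ γ⌉₊ ≤ ⌈(m : ℝ) ^ γ⌉₊ + 1 := by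
    rw [← Nat.ceil_add_one (by positivity)]
    exact Nat.ceil_mono (add_rpow_le_rpow_add h0 h1 (Nat.cast_nonneg m) le_rfl)
  omega

/-- The identity ⌈y⌉ = y + {-y} is what makes the sawtooth appear at negated powers, which form a
convex sequence. -/
theorem card_Ico_ceil_rpow_eq {γ : ℝ} (h0 : 0 < γ) (m : ℕ) :
    ((Finset.Ico ⌈(m : ℝ) ^ γ⌉₊ ⌈((m : ℝ) + 1) ^ γ⌉₊).card : ℝ) =
      (((m : ℝ) + 1) ^ γ - (m : ℝ) ^ γ) + (Int.fract (-((m : ℝ) + 1) ^ γ) - 1 / 2) -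
        (Int.fract (-(m : ℝ) ^ γ) - 1 / 2) := by
  have hceil : ∀ y : ℝ, 0 ≤ y → (⌈y⌉₊ : ℝ) = y + Int.fract (-y) := by
    intro y hy
    have h := Int.self_sub_floor (-y)
    rw [Int.floor_neg] at h
    have h2 : (⌈y⌉₊ : ℝ) = (⌈y⌉ : ℤ) := by
      exact_mod_cast congrArg (Int.cast (R := ℝ)) (Int.natCast_ceil_eq_ceil hy)
    push_cast at h
    rw [h2]; linarith
  rw [Nat.card_Ico, Nat.cast_sub (Nat.ceil_mono (Real.rpow_le_rpow (by positivity) (by linarith)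
    h0.le)), hceil _ (by positivity), hceil _ (by positivity)]
  ring

/-- Both y and x + 1 are convex combinations of x and y + 1, with the two weights swapped; adding
the two concavity inequalities gives the claim. -/
theorem rpow_add_one_sub_antitone {γ : ℝ} (h0 : 0 < γ) (h1 : γ < 1) {x y : ℝ} (hx : 0 ≤ x)
    (hxy : x ≤ y) : (y + 1) ^ γ - y ^ γ ≤ (x + 1) ^ γ - x ^ γ := by
  have hconc := (Real.concaveOn_rpow h0.le h1.le).2
  set δ := y - x with hδ
  have hδ0 : 0 ≤ δ := by linarith
  have hx' : x ∈ Set.Ici (0 : ℝ) := hx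
  have hy' : y + 1 ∈ Set.Ici (0 : ℝ) := by simp only [Set.mem_Ici]; linarith
  have ht : 1 / (1 + δ) + δ / (1 + δ) = 1 := by field_simp
  have a1 := hconc hx' hy' (show 0 ≤ 1 / (1 + δ) by positivity) (show 0 ≤ δ / (1 + δ) by positivity)
    ht
  have a2 := hconc hx' hy' (show 0 ≤ δ / (1 + δ) by positivity) (show 0 ≤ 1 / (1 + δ) by positivity)
    (by rw [add_comm]; exact ht)
  have hy : y = x + δ := by linarith
  simp only [smul_eq_mul] at a1 a2
  have b1 : 1 / (1 + δ) * x + δ / (1 + δ) * (y + 1) = y := by rw [hy]; field_simp; ring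
  have b2 : δ / (1 + δ) * x + 1 / (1 + δ) * (y + 1) = x + 1 := by rw [hy]; field_simp; ring
  rw [b1] at a1
  rw [b2] at a2
  have : x ^ γ + (y + 1) ^ γ = (1 / (1 + δ) * x ^ γ + δ / (1 + δ) * (y + 1) ^ γ) +
      (δ / (1 + δ) * x ^ γ + 1 / (1 + δ) * (y + 1) ^ γ) := by
    linear_combination (-(x ^ γ) - (y + 1) ^ γ) * ht
  linarith

theorem rpow_add_natCast_sub_mem_Icc {γ : ℝ} (h0 : 0 < γ) (h1 : γ < 1) {x : ℝ} (hx : 0 ≤ x)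
    (q : ℕ) : (x + q) ^ γ - x ^ γ ∈
      Set.Icc (q * ((x + q + 1) ^ γ - (x + q) ^ γ)) (q * ((x + 1) ^ γ - x ^ γ)) := by
  have hs : (x + q) ^ γ - x ^ γ = ∑ j ∈ Finset.range q, ((x + j + 1) ^ γ - (x + j) ^ γ) := by
    have := Finset.sum_range_sub (fun j : ℕ => (x + j) ^ γ) q
    simp only [Nat.cast_zero, add_zero] at this
    rw [← this]
    refine Finset.sum_congr rfl fun j _ => ?_
    push_cast; ring_nf
  rw [hs]
  constructor
  · have := Finset.card_nsmul_le_sum (Finset.range q)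
      (fun j : ℕ => (x + j + 1) ^ γ - (x + j) ^ γ) ((x + q + 1) ^ γ - (x + q) ^ γ) (fun j hj => by
        have : (j : ℝ) ≤ q := by exact_mod_cast (Finset.mem_range.1 hj).le
        exact rpow_add_one_sub_antitone h0 h1 (by positivity) (by linarith))
    simpa using this
  · have := Finset.sum_le_card_nsmul (Finset.range q)
      (fun j : ℕ => (x + j + 1) ^ γ - (x + j) ^ γ) ((x + 1) ^ γ - x ^ γ) (fun j hj => by
        have : (0 : ℝ) ≤ j := Nat.cast_nonneg j
        exact rpow_add_one_sub_antitone h0 h1 hx (by linarith))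
    simpa using this

/-- By concavity the increment over a full period q lies between q w (k+1) and q w k, where w k is
the unit increment at q k + a. Summing, the discrepancy telescopes to at most q (w u - w v) ≤ q. -/
theorem abs_mul_sum_rpow_add_one_sub_le {γ : ℝ} (h0 : 0 < γ) (h1 : γ < 1) (q a u v : ℕ)
    (hq : 0 < q) (huv : u ≤ v) :
    |q * ∑ k ∈ Finset.Ico u v, (((q * k + a : ℕ) + 1 : ℝ) ^ γ - ((q * k + a : ℕ) : ℝ) ^ γ) -
      (((q * v + a : ℕ) : ℝ) ^ γ - ((q * u + a : ℕ) : ℝ) ^ γ)| ≤ q := by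
  set w : ℕ → ℝ := fun k => ((q * k + a : ℕ) + 1 : ℝ) ^ γ - ((q * k + a : ℕ) : ℝ) ^ γ with hw
  have hqr : (0 : ℝ) < q := by exact_mod_cast hq
  have hstep : ∀ k : ℕ, ((q * (k + 1) + a : ℕ) : ℝ) ^ γ - ((q * k + a : ℕ) : ℝ) ^ γ ∈
      Set.Icc (q * w (k + 1)) (q * w k) := by
    intro k
    have := rpow_add_natCast_sub_mem_Icc h0 h1 (Nat.cast_nonneg (q * k + a)) q
    have e : ((q * (k + 1) + a : ℕ) : ℝ) = ((q * k + a : ℕ) : ℝ) + q := by push_cast; ring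
    simp only [hw, e]
    exact this
  have htel : ∑ k ∈ Finset.Ico u v, (((q * (k + 1) + a : ℕ) : ℝ) ^ γ - ((q * k + a : ℕ) : ℝ) ^ γ) =
      ((q * v + a : ℕ) : ℝ) ^ γ - ((q * u + a : ℕ) : ℝ) ^ γ :=
    Finset.sum_Ico_sub (fun k : ℕ => ((q * k + a : ℕ) : ℝ) ^ γ) huv
  have hup : ((q * v + a : ℕ) : ℝ) ^ γ - ((q * u + a : ℕ) : ℝ) ^ γ ≤
      q * ∑ k ∈ Finset.Ico u v, w k := by
    rw [← htel, Finset.mul_sum]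
    exact Finset.sum_le_sum fun k _ => (hstep k).2
  have hlo : q * ∑ k ∈ Finset.Ico u v, w (k + 1) ≤
      ((q * v + a : ℕ) : ℝ) ^ γ - ((q * u + a : ℕ) : ℝ) ^ γ := by
    rw [← htel, Finset.mul_sum]
    exact Finset.sum_le_sum fun k _ => (hstep k).1
  have hsh : ∑ k ∈ Finset.Ico u v, w (k + 1) = ∑ k ∈ Finset.Ico u v, w k + (w v - w u) := by
    rw [← Finset.sum_Ico_sub w huv, ← Finset.sum_add_distrib]
    simp
  have hwu : w u ≤ 1 := by
    have := add_rpow_le_rpow_add h0 h1 (Nat.cast_nonneg (q * u + a)) (le_refl (1 : ℝ))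
    simp only [hw]; linarith
  have hwv : 0 ≤ w v := by
    have := Real.rpow_le_rpow (Nat.cast_nonneg (q * v + a))
      (show ((q * v + a : ℕ) : ℝ) ≤ (q * v + a : ℕ) + 1 by linarith) h0.le
    simp only [hw]; linarith
  rw [hsh] at hlo
  rw [abs_le]
  constructor <;> nlinarith

/-- The number of `n ∈ (X / 2, X]` with `⌊n ^ c⌋` in a fixed residue class modulo `q`. -/
noncomputable def residueCount (c X : ℝ) (q a : ℕ) : ℕ :=
  ((Finset.Icc 1 ⌊X⌋₊).filter fun n : ℕ => X / 2 < (n : ℝ) ∧ ⌊(n : ℝ) ^ c⌋₊ % q = a).card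

/-- Grouping n by k = [n^c] / q, only the two extreme values of k can give incomplete fibres, and
each interval holds at most one integer; hence the loss of 2. -/
theorem residueCount_mem_Icc {c X : ℝ} (hc : 1 < c) (hX : 0 < X) {q a : ℕ} (ha : a < q) :
    (residueCount c X q a : ℤ) ∈ Set.Icc
      (∑ k ∈ Finset.Ico ⌊(X / 2) ^ c / q⌋₊ (⌊X ^ c / q⌋₊ + 1),
        ((Finset.Ico ⌈((q * k + a : ℕ) : ℝ) ^ c⁻¹⌉₊ ⌈((q * k + a : ℕ) + 1 : ℝ) ^ c⁻¹⌉₊).card : ℤ) - 2)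
      (∑ k ∈ Finset.Ico ⌊(X / 2) ^ c / q⌋₊ (⌊X ^ c / q⌋₊ + 1),
        ((Finset.Ico ⌈((q * k + a : ℕ) : ℝ) ^ c⁻¹⌉₊ ⌈((q * k + a : ℕ) + 1 : ℝ) ^ c⁻¹⌉₊).card : ℤ)) := by
  have hc0 : 0 < c := by linarith
  have hq : 0 < q := by omega
  have hqr : (0 : ℝ) < q := by exact_mod_cast hq
  set u := ⌊(X / 2) ^ c / q⌋₊ with hu
  set v := ⌊X ^ c / q⌋₊ with hv
  set F := (Finset.Icc 1 ⌊X⌋₊).filter fun n : ℕ => X / 2 < (n : ℝ) ∧ ⌊(n : ℝ) ^ c⌋₊ % q = a with hF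
  set I : ℕ → Finset ℕ := fun k =>
    Finset.Ico ⌈((q * k + a : ℕ) : ℝ) ^ c⁻¹⌉₊ ⌈((q * k + a : ℕ) + 1 : ℝ) ^ c⁻¹⌉₊ with hI
  have hmaps : ∀ n ∈ F, ⌊(n : ℝ) ^ c⌋₊ / q ∈ Finset.Ico u (v + 1) := by
    intro n hn
    simp only [hF, Finset.mem_filter, Finset.mem_Icc] at hn
    have hnX : (n : ℝ) ≤ X := (Nat.le_floor_iff hX.le).1 hn.1.2
    rw [← Nat.floor_div_natCast, Finset.mem_Ico, Nat.lt_succ_iff]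
    constructor
    · refine Nat.floor_mono ?_
      gcongr
      exact hn.2.1.le
    · refine Nat.floor_mono ?_
      gcongr
  have hcard := Finset.card_eq_sum_card_fiberwise hmaps
  set fib : ℕ → Finset ℕ := fun k => F.filter fun n : ℕ => ⌊(n : ℝ) ^ c⌋₊ / q = k with hfib
  have hsub : ∀ k, fib k ⊆ I k := by
    intro k n hn
    simp only [hfib, hF, Finset.mem_filter] at hn
    simp only [hI]
    rw [mem_Ico_ceil_rpow_inv_iff hc0]
    have := Nat.div_add_mod ⌊(n : ℝ) ^ c⌋₊ q
    rw [hn.2, hn.1.2.2] at this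
    exact this.symm
  have heq : ∀ k, u < k → k < v → I k ⊆ fib k := by
    intro k huk hkv n hn
    simp only [hI] at hn
    rw [mem_Ico_ceil_rpow_inv_iff hc0] at hn
    have hdiv : (q * k + a) / q = k := by
      rw [Nat.mul_add_div hq, Nat.div_eq_of_lt ha, add_zero]
    have hmod : (q * k + a) % q = a := by
      rw [Nat.mul_add_mod, Nat.mod_eq_of_lt ha]
    have hfl := (Nat.floor_eq_iff (show 0 ≤ (n : ℝ) ^ c by positivity)).1 hn
    push_cast at hfl
    have h1 : (X / 2) ^ c < (n : ℝ) ^ c := by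
      have e1 : (X / 2) ^ c / q < u + 1 := Nat.lt_floor_add_one _
      have e2 : (u : ℝ) + 1 ≤ k := by exact_mod_cast huk
      rw [div_lt_iff₀ hqr] at e1
      have : ((u : ℝ) + 1) * q ≤ k * q := by gcongr
      have : (0 : ℝ) ≤ a := Nat.cast_nonneg a
      linarith
    have h2 : (n : ℝ) ^ c < X ^ c := by
      have e1 : (v : ℝ) ≤ X ^ c / q := Nat.floor_le (by positivity)
      have e2 : (k : ℝ) + 1 ≤ v := by exact_mod_cast hkv
      have e3 : (a : ℝ) + 1 ≤ q := by exact_mod_cast ha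
      rw [le_div_iff₀ hqr] at e1
      have : ((k : ℝ) + 1) * q ≤ v * q := by gcongr
      linarith
    have h3 := (Real.rpow_lt_rpow_iff (by positivity) (Nat.cast_nonneg n) hc0).1 h1
    have h4 := (Real.rpow_lt_rpow_iff (Nat.cast_nonneg n) hX.le hc0).1 h2
    have h5 : (0 : ℝ) < n := by linarith
    simp only [hfib, hF, Finset.mem_filter, Finset.mem_Icc]
    refine ⟨⟨⟨by exact_mod_cast h5, Nat.le_floor h4.le⟩, h3, ?_⟩, ?_⟩
    · rw [hn, hmod]
    · rw [hn, hdiv]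
  have hcard' : (residueCount c X q a : ℤ) = ∑ k ∈ Finset.Ico u (v + 1), ((fib k).card : ℤ) := by
    rw [residueCount, hcard]; push_cast; rfl
  rw [hcard']
  constructor
  · have hle : ∀ k ∈ Finset.Ico u (v + 1), ((I k).card : ℤ) ≤
        (fib k).card + ((if k = u then 1 else 0) + (if k = v then 1 else 0)) := by
      intro k hk
      rw [Finset.mem_Ico] at hk
      have h1 : (I k).card ≤ 1 := card_Ico_ceil_rpow_le_one (by positivity)
        (inv_lt_one_of_one_lt₀ hc) _
      by_cases hku : k = u
      · simp only [hku, if_true] at h1 ⊢; split_ifs <;> omega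
      by_cases hkv : k = v
      · simp only [hkv, if_true] at h1 ⊢; split_ifs <;> omega
      have := Finset.card_le_card (heq k (by omega) (by omega))
      simp only [hku, hkv, if_false]; omega
    have := Finset.sum_le_sum hle
    rw [Finset.sum_add_distrib, Finset.sum_add_distrib, Finset.sum_ite_eq', Finset.sum_ite_eq']
      at this
    have h2 : ((if u ∈ Finset.Ico u (v + 1) then 1 else 0 : ℤ)) ≤ 1 := by split_ifs <;> omega
    have h3 : ((if v ∈ Finset.Ico u (v + 1) then 1 else 0 : ℤ)) ≤ 1 := by split_ifs <;> omega
    linarith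
  · exact Finset.sum_le_sum fun k _ => Nat.cast_le.2 (Finset.card_le_card (hsub k))

set_option maxHeartbeats 800000 in
/-- Equidistribution of `⌊n ^ c⌋` in residue classes to square moduli. -/
theorem exists_abs_residueCount_sub_le {c : ℝ} (hc₁ : 1 < c) (hc₂ : c < 7 / 6) :
    ∃ C : ℝ, 0 < C ∧ ∀ X : ℝ, 64 ≤ X → ∀ e a : ℕ, 0 < e →
      (e : ℝ) ≤ (X ^ ((2 * c - 1) / 8)) ^ 2 → a < e ^ 2 →
      |(residueCount c X (e ^ 2) a : ℝ) - X / (2 * (e : ℝ) ^ 2)| ≤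
        C * (X ^ c / (X ^ ((2 * c - 1) / 8) * √(e : ℝ) ^ 3)) := by
  have hc0 : 0 < c := by linarith
  have hγ0 : 0 < c⁻¹ := by positivity
  have hγ1 : c⁻¹ < 1 := inv_lt_one_of_one_lt₀ hc₁
  obtain ⟨C, hC0, hC⟩ := exists_abs_sum_fract_neg_rpow_le hγ0 hγ1
  refine ⟨2 * C + 6, by positivity, ?_⟩
  intro X hX e a he heD ha
  have hX0 : 0 < X := by linarith
  have hX1 : 1 ≤ X := by linarith
  set D := X ^ ((2 * c - 1) / 8) with hD
  set Y := X ^ c with hY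
  have hY0 : 0 < Y := Real.rpow_pos_of_pos hX0 c
  have hD1 : 1 ≤ D := Real.one_le_rpow hX1 (by linarith)
  have hD0 : 0 < D := by linarith
  have hDn : ∀ n : ℕ, D ^ n = X ^ ((2 * c - 1) / 8 * n) := fun n => by
    rw [hD, Real.rpow_mul_natCast hX0.le]
  -- The bound c ≤ 7/6 is used here in the form 7(2c-1)/8 ≤ c.
  have hD7 : D ^ 7 ≤ Y := by
    rw [hDn, hY]
    exact Real.rpow_le_rpow_of_exponent_le hX1 (by push_cast; linarith)
  have hYD : Y ^ (c⁻¹ - 2) = (D ^ 8)⁻¹ := by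
    rw [hDn, hY, ← Real.rpow_mul hX0.le, ← Real.rpow_neg hX0.le]
    congr 1
    push_cast
    field_simp
    ring
  -- D⁴ = X^(c-1/2), so this is √X ≥ 8. It makes the modulus e² ≤ D⁴ negligible against Y at both
  -- ends of the range of k.
  have hD4 : 8 * D ^ 4 ≤ Y := by
    have h1 : (8 : ℝ) ≤ X ^ (1 / 2 : ℝ) := by
      calc (8 : ℝ) = √64 := by rw [show (64 : ℝ) = 8 ^ 2 by norm_num]; simp
        _ ≤ √X := Real.sqrt_le_sqrt hX
        _ = _ := Real.sqrt_eq_rpow X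
    calc 8 * D ^ 4 ≤ X ^ (1 / 2 : ℝ) * D ^ 4 := by gcongr
      _ = Y := by
        rw [hDn, hY, ← Real.rpow_add hX0]
        congr 1; push_cast; ring
  have he1 : (1 : ℝ) ≤ e := by exact_mod_cast he
  have heq : (1 : ℝ) ≤ (e : ℝ) ^ 2 := one_le_pow₀ he1
  have heq0 : (0 : ℝ) < (e : ℝ) ^ 2 := by linarith
  have hqD : (e : ℝ) ^ 2 ≤ D ^ 4 := by
    calc (e : ℝ) ^ 2 ≤ (D ^ 2) ^ 2 := by gcongr
      _ = D ^ 4 := by ring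
  have har : (a : ℝ) + 1 ≤ (e : ℝ) ^ 2 := by exact_mod_cast ha
  have ha0 : (0 : ℝ) ≤ a := Nat.cast_nonneg a
  have hX2 : Y / 4 ≤ (X / 2) ^ c := by
    rw [Real.div_rpow hX0.le (by norm_num)]
    gcongr
    calc (2 : ℝ) ^ c ≤ 2 ^ (2 : ℝ) := Real.rpow_le_rpow_of_exponent_le (by norm_num) (by linarith)
      _ = 4 := by norm_num
  have hXY : (X / 2) ^ c ≤ Y := Real.rpow_le_rpow (by positivity) (by linarith) hc0.le
  have hmem := residueCount_mem_Icc hc₁ hX0 ha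
  set q : ℕ := e ^ 2 with hq
  have hqr : (q : ℝ) = (e : ℝ) ^ 2 := by rw [hq]; push_cast; rfl
  have hq0 : 0 < q := by positivity
  set u := ⌊(X / 2) ^ c / q⌋₊ with hu
  set v := ⌊Y / q⌋₊ with hv
  have hu1 : (u : ℝ) * (e : ℝ) ^ 2 ≤ (X / 2) ^ c := by
    rw [← le_div_iff₀ heq0, ← hqr]; exact Nat.floor_le (by positivity)
  have hu2 : (X / 2) ^ c < ((u : ℝ) + 1) * (e : ℝ) ^ 2 := by
    rw [← div_lt_iff₀ heq0, ← hqr]; exact Nat.lt_floor_add_one _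
  have hv1 : (v : ℝ) * (e : ℝ) ^ 2 ≤ Y := by
    rw [← le_div_iff₀ heq0, ← hqr]; exact Nat.floor_le (by positivity)
  have hv2 : Y < ((v : ℝ) + 1) * (e : ℝ) ^ 2 := by
    rw [← div_lt_iff₀ heq0, ← hqr]; exact Nat.lt_floor_add_one _
  have huv : u < v + 1 := by
    rw [Nat.lt_succ_iff]; exact Nat.floor_mono (by gcongr)
  have hsaw : ∀ b : ℕ, b ≤ e ^ 2 →
      |∑ k ∈ Finset.Ico u (v + 1), (Int.fract (-((e : ℝ) ^ 2 * k + b) ^ c⁻¹) - 1 / 2)| ≤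
        C * (Y / (D * √(e : ℝ) ^ 3)) := fun b hb =>
    hC Y D e b u (v + 1) hY0 hD1 hYD hD7 he heD hb huv (by linarith) (by push_cast; linarith)
  have hs1 := hsaw (a + 1) ha
  have hs0 := hsaw a ha.le
  set T := Y / (D * √(e : ℝ) ^ 3) with hT
  have hT1 : 1 ≤ T := by
    have h1 : √(e : ℝ) ≤ D := Real.sqrt_le_iff.2 ⟨hD0.le, heD⟩
    have h2 : 0 < √(e : ℝ) := Real.sqrt_pos.2 (by linarith)
    rw [hT, one_le_div (by positivity)]
    calc D * √(e : ℝ) ^ 3 ≤ D * D ^ 3 := by gcongr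
      _ = D ^ 4 := by ring
      _ ≤ Y := by
        have : 0 < D ^ 4 := by positivity
        linarith
  have hsum : (∑ k ∈ Finset.Ico u (v + 1), ((Finset.Ico ⌈((q * k + a : ℕ) : ℝ) ^ c⁻¹⌉₊
      ⌈((q * k + a : ℕ) + 1 : ℝ) ^ c⁻¹⌉₊).card : ℝ)) =
      ∑ k ∈ Finset.Ico u (v + 1),
        (((q * k + a : ℕ) + 1 : ℝ) ^ c⁻¹ - ((q * k + a : ℕ) : ℝ) ^ c⁻¹) +
      ∑ k ∈ Finset.Ico u (v + 1),
        (Int.fract (-((e : ℝ) ^ 2 * k + (a + 1 : ℕ)) ^ c⁻¹) - 1 / 2) -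
      ∑ k ∈ Finset.Ico u (v + 1), (Int.fract (-((e : ℝ) ^ 2 * k + a) ^ c⁻¹) - 1 / 2) := by
    rw [← Finset.sum_add_distrib, ← Finset.sum_sub_distrib]
    refine Finset.sum_congr rfl fun k _ => ?_
    rw [card_Ico_ceil_rpow_eq hγ0]
    push_cast [hqr]
    rw [add_assoc]
  have hU := abs_mul_sum_rpow_add_one_sub_le hγ0 hγ1 q a u (v + 1) hq0 huv.le
  rw [hqr] at hU
  set U := ∑ k ∈ Finset.Ico u (v + 1),
        (((q * k + a : ℕ) + 1 : ℝ) ^ c⁻¹ - ((q * k + a : ℕ) : ℝ) ^ c⁻¹) with hUdef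
  have hinv : ∀ Z : ℝ, 0 ≤ Z → (Z ^ c) ^ c⁻¹ = Z := fun Z hZ => Real.rpow_rpow_inv hZ hc0.ne'
  have hgv1 : X ≤ ((q * (v + 1) + a : ℕ) : ℝ) ^ c⁻¹ := by
    calc X = Y ^ c⁻¹ := (hinv X hX0.le).symm
      _ ≤ _ := Real.rpow_le_rpow hY0.le (by push_cast [hqr]; linarith) hγ0.le
  have hgv2 : ((q * (v + 1) + a : ℕ) : ℝ) ^ c⁻¹ ≤ X + 2 * (e : ℝ) ^ 2 := by
    calc ((q * (v + 1) + a : ℕ) : ℝ) ^ c⁻¹ ≤ (Y + 2 * (e : ℝ) ^ 2) ^ c⁻¹ :=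
          Real.rpow_le_rpow (Nat.cast_nonneg _) (by push_cast [hqr]; linarith) hγ0.le
      _ ≤ Y ^ c⁻¹ + 2 * (e : ℝ) ^ 2 := add_rpow_le_rpow_add hγ0 hγ1 hY0.le (by linarith)
      _ = _ := by rw [hY, hinv X hX0.le]
  have hgu1 : X / 2 ≤ ((q * u + a : ℕ) : ℝ) ^ c⁻¹ + (e : ℝ) ^ 2 := by
    calc X / 2 = ((X / 2) ^ c) ^ c⁻¹ := (hinv _ (by positivity)).symm
      _ ≤ (((q * u + a : ℕ) : ℝ) + (e : ℝ) ^ 2) ^ c⁻¹ :=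
          Real.rpow_le_rpow (by positivity) (by push_cast [hqr]; linarith) hγ0.le
      _ ≤ _ := add_rpow_le_rpow_add hγ0 hγ1 (Nat.cast_nonneg _) heq
  have hgu2 : ((q * u + a : ℕ) : ℝ) ^ c⁻¹ ≤ X / 2 + (e : ℝ) ^ 2 := by
    calc ((q * u + a : ℕ) : ℝ) ^ c⁻¹ ≤ ((X / 2) ^ c + (e : ℝ) ^ 2) ^ c⁻¹ :=
          Real.rpow_le_rpow (Nat.cast_nonneg _) (by push_cast [hqr]; linarith) hγ0.le
      _ ≤ ((X / 2) ^ c) ^ c⁻¹ + (e : ℝ) ^ 2 :=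
          add_rpow_le_rpow_add hγ0 hγ1 (by positivity) heq
      _ = _ := by rw [hinv _ (by positivity)]
  -- e² U is within e² of the difference of the endpoint powers, which lies between X/2 - e² and X/2
  -- + 3e².
  have hUX : |U - X / (2 * (e : ℝ) ^ 2)| ≤ 4 := by
    have e1 : U - X / (2 * (e : ℝ) ^ 2) = ((e : ℝ) ^ 2 * U - X / 2) / (e : ℝ) ^ 2 := by field_simp
    rw [e1, abs_div, abs_of_pos heq0, div_le_iff₀ heq0]
    have := abs_le.1 hU
    rw [abs_le]
    constructor <;> linarith
  obtain ⟨hm1, hm2⟩ := hmem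
  have hm1' := (Int.cast_le (R := ℝ)).2 hm1
  have hm2' := (Int.cast_le (R := ℝ)).2 hm2
  push_cast at hm1' hm2' hsum
  rw [hsum] at hm1' hm2'
  push_cast at hs1 hs0 hUX
  rw [abs_le] at hs1 hs0 hUX ⊢
  constructor <;> linarith

/-! ### Divisor bounds and square divisors -/

/-- Compare τ(n) = ∏ (k+1) with n^ε prime by prime. If p ≥ 2^(1/ε), then k + 1 ≤ 2^k ≤ p^(kε). Each
of the boundedly many smaller primes costs one factor A, chosen so that A ε log 2 ≥ 1. -/
theorem exists_card_divisors_le_rpow {ε : ℝ} (hε : 0 < ε) :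
    ∃ C : ℝ, 1 ≤ C ∧ ∀ n : ℕ, 0 < n → (n.divisors.card : ℝ) ≤ C * (n : ℝ) ^ ε := by
  have hl2 : 0 < Real.log 2 := Real.log_pos (by norm_num)
  set A : ℝ := 1 + 1 / (ε * Real.log 2) with hA
  have hA1 : 1 ≤ A := by
    have : 0 < 1 / (ε * Real.log 2) := by positivity
    linarith
  set P : ℕ := ⌈(2 : ℝ) ^ (1 / ε)⌉₊ with hP
  refine ⟨A ^ P, one_le_pow₀ hA1, fun n hn => ?_⟩
  have hsmall : ∀ p k : ℕ, 2 ≤ p → ((k : ℝ) + 1) ≤ A * ((p : ℝ) ^ k) ^ ε := by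
    intro p k hp
    have hp' : (2 : ℝ) ≤ p := by exact_mod_cast hp
    have h1 : 1 + k * ε * Real.log 2 ≤ ((p : ℝ) ^ k) ^ ε := by
      calc 1 + k * ε * Real.log 2 ≤ Real.exp (k * ε * Real.log 2) := by
            rw [add_comm]; exact Real.add_one_le_exp _
        _ = ((2 : ℝ) ^ k) ^ ε := by
            rw [← Real.rpow_natCast, ← Real.rpow_mul (by norm_num),
              Real.rpow_def_of_pos (by norm_num)]
            ring_nf
        _ ≤ _ := by gcongr
    have h2 : A * (1 + k * ε * Real.log 2) = A + k * (ε * Real.log 2) + k := by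
      rw [hA]; field_simp; ring
    have h3 : 0 ≤ k * (ε * Real.log 2) := by positivity
    nlinarith
  have hlarge : ∀ p k : ℕ, P ≤ p → ((k : ℝ) + 1) ≤ ((p : ℝ) ^ k) ^ ε := by
    intro p k hp
    have hp' : (2 : ℝ) ^ (1 / ε) ≤ p := (Nat.le_ceil _).trans (by exact_mod_cast hp)
    have h1 : (2 : ℝ) ≤ (p : ℝ) ^ ε := by
      calc (2 : ℝ) = ((2 : ℝ) ^ (1 / ε)) ^ ε := by
            rw [← Real.rpow_mul (by norm_num), one_div_mul_cancel hε.ne', Real.rpow_one]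
        _ ≤ _ := by gcongr
    have h2 : ((p : ℝ) ^ k) ^ ε = ((p : ℝ) ^ ε) ^ k := by
      rw [← Real.rpow_natCast, ← Real.rpow_mul (by positivity), mul_comm, Real.rpow_mul
        (by positivity), Real.rpow_natCast]
    rw [h2]
    calc (k : ℝ) + 1 ≤ 2 ^ k := by exact_mod_cast Nat.lt_two_pow_self
      _ ≤ _ := by gcongr
  have hn' : (n : ℝ) ^ ε = ∏ p ∈ n.primeFactors, ((p : ℝ) ^ n.factorization p) ^ ε := by
    rw [Real.finsetProd_rpow _ _ (fun p _ => by positivity)]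
    congr 1
    conv_lhs => rw [← Nat.prod_factorization_pow_eq_self hn.ne']
    simp [Finsupp.prod]
  rw [Nat.card_divisors hn.ne', hn']
  push_cast
  have hstep : ∀ p ∈ n.primeFactors, (n.factorization p : ℝ) + 1 ≤
      (if p < P then A else 1) * ((p : ℝ) ^ n.factorization p) ^ ε := by
    intro p hp
    split_ifs with h
    · exact hsmall p _ (Nat.prime_of_mem_primeFactors hp).two_le
    · rw [one_mul]; exact hlarge p _ (not_lt.1 h)
  refine (Finset.prod_le_prod (fun p _ => by positivity) hstep).trans ?_
  rw [Finset.prod_mul_distrib]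
  refine mul_le_mul_of_nonneg_right ?_ (Finset.prod_nonneg fun p _ => by positivity)
  rw [Finset.prod_ite, Finset.prod_const_one, mul_one, Finset.prod_const]
  refine pow_le_pow_right₀ hA1 ?_
  calc (n.primeFactors.filter (· < P)).card ≤ (Finset.range P).card :=
        Finset.card_le_card fun p hp => Finset.mem_range.2 (Finset.mem_filter.1 hp).2
    _ = P := Finset.card_range P

/-- The positive integers whose square divides `m`. -/
def squareDivisors (m : ℕ) : Finset ℕ := (Finset.Icc 1 m).filter fun d => d ^ 2 ∣ m

theorem mem_squareDivisors {m d : ℕ} (hm : 0 < m) : d ∈ squareDivisors m ↔ d ^ 2 ∣ m := by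
  simp only [squareDivisors, Finset.mem_filter, Finset.mem_Icc, and_iff_right_iff_imp]
  intro h
  have h0 : d ≠ 0 := by rintro rfl; simp at h; omega
  exact ⟨by omega, (Nat.le_self_pow (by norm_num) d).trans (Nat.le_of_dvd hm h)⟩

theorem dvd_of_sq_dvd_sq_mul_squarefree {a b d : ℕ} (hb : 0 < b) (ha : Squarefree a)
    (h : d ^ 2 ∣ b ^ 2 * a) : d ∣ b := by
  obtain ⟨g, d', b', hg, hco, rfl, rfl⟩ := Nat.exists_coprime' (Nat.gcd_pos_of_pos_right d hb)
  have h2 : d' ^ 2 ∣ b' ^ 2 * a := by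
    have : g ^ 2 * d' ^ 2 ∣ g ^ 2 * (b' ^ 2 * a) := by
      convert h using 1 <;> ring
    exact (Nat.mul_dvd_mul_iff_left (by positivity)).1 this
  have h3 : d' ^ 2 ∣ a := (Nat.Coprime.pow 2 2 hco).dvd_of_dvd_mul_left h2
  have h4 : d' = 1 := by
    have := ha d' (by rwa [← sq])
    exact Nat.isUnit_iff.1 this
  rw [h4, one_mul]
  exact Dvd.intro_left _ rfl

/-- Writing m = b² a with a square-free, d² ∣ m means d ∣ b. Both the Möbius identity and the bound
for square divisors thus reduce to ordinary divisors of b. -/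
theorem exists_squareDivisors_eq_divisors {m : ℕ} (hm : 0 < m) :
    ∃ b : ℕ, 0 < b ∧ b ≤ m ∧ squareDivisors m = b.divisors ∧ (Squarefree m ↔ b = 1) := by
  obtain ⟨a, b, ha, hb, hab, hsq⟩ := Nat.sq_mul_squarefree_of_pos hm
  have hbm : b ^ 2 ∣ m := ⟨a, hab.symm⟩
  refine ⟨b, hb, (Nat.le_self_pow (by norm_num) b).trans (Nat.le_of_dvd hm hbm), ?_, ?_⟩
  · ext d
    rw [mem_squareDivisors hm, Nat.mem_divisors]
    constructor
    · intro h
      rw [← hab] at h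
      exact ⟨dvd_of_sq_dvd_sq_mul_squarefree hb hsq h, hb.ne'⟩
    · rintro ⟨h, -⟩
      exact (pow_dvd_pow_of_dvd h 2).trans hbm
  · constructor
    · intro h
      exact Nat.isUnit_iff.1 (h b (by rwa [← sq]))
    · rintro rfl
      rw [← hab]; simpa using hsq

theorem moebius_sq_eq_sum_squareDivisors {m : ℕ} (hm : 0 < m) :
    (ArithmeticFunction.moebius m : ℝ) ^ 2 =
      ∑ d ∈ squareDivisors m, (ArithmeticFunction.moebius d : ℝ) := by
  obtain ⟨b, hb, -, hdiv, hsq⟩ := exists_squareDivisors_eq_divisors hm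
  rw [hdiv]
  have h1 : ∑ d ∈ b.divisors, ArithmeticFunction.moebius d = if b = 1 then 1 else 0 := by
    rw [← ArithmeticFunction.coe_mul_zeta_apply, ArithmeticFunction.moebius_mul_coe_zeta,
      ArithmeticFunction.one_apply]
  have h2 : ArithmeticFunction.moebius m ^ 2 = if b = 1 then 1 else 0 := by
    rw [ArithmeticFunction.moebius_sq]
    simp only [hsq]
  exact_mod_cast h2.trans h1.symm

theorem exists_card_squareDivisors_le_rpow {ε : ℝ} (hε : 0 < ε) :
    ∃ C : ℝ, 1 ≤ C ∧ ∀ m : ℕ, 0 < m → ((squareDivisors m).card : ℝ) ≤ C * (m : ℝ) ^ ε := by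
  obtain ⟨C, hC, h⟩ := exists_card_divisors_le_rpow hε
  refine ⟨C, hC, fun m hm => ?_⟩
  obtain ⟨b, hb, hbm, hdiv, -⟩ := exists_squareDivisors_eq_divisors hm
  rw [hdiv]
  refine (h b hb).trans ?_
  gcongr

/-- The Möbius sum detecting square-free numbers, truncated at `z`. -/
noncomputable def truncatedSquarefree (z m : ℕ) : ℝ :=
  ∑ d ∈ Finset.Icc 1 z, if d ^ 2 ∣ m then (ArithmeticFunction.moebius d : ℝ) else 0

/-- The square divisors of `m` with root larger than `z`. -/
def largeSquareDivisors (z m : ℕ) : Finset ℕ := (squareDivisors m).filter fun d => z < d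

theorem abs_moebius_cast_le_one (d : ℕ) : |(ArithmeticFunction.moebius d : ℝ)| ≤ 1 := by
  exact_mod_cast ArithmeticFunction.abs_moebius_le_one (n := d)

theorem truncatedSquarefree_eq {z m : ℕ} (hm : 0 < m) : truncatedSquarefree z m =
    ∑ d ∈ (squareDivisors m).filter (fun d => ¬ z < d), (ArithmeticFunction.moebius d : ℝ) := by
  rw [truncatedSquarefree, ← Finset.sum_filter]
  refine Finset.sum_congr ?_ fun _ _ => rfl
  ext d
  simp only [Finset.mem_filter, Finset.mem_Icc, mem_squareDivisors hm, not_lt]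
  constructor
  · rintro ⟨⟨h1, h2⟩, h3⟩; exact ⟨h3, h2⟩
  · rintro ⟨h3, h2⟩
    have := (mem_squareDivisors hm).2 h3
    simp only [squareDivisors, Finset.mem_filter, Finset.mem_Icc] at this
    exact ⟨⟨this.1.1, h2⟩, h3⟩

theorem abs_sum_moebius_le_card (s : Finset ℕ) :
    |∑ d ∈ s, (ArithmeticFunction.moebius d : ℝ)| ≤ s.card := by
  refine (Finset.abs_sum_le_sum_abs _ _).trans ?_
  exact (Finset.sum_le_card_nsmul _ _ 1 fun d _ => abs_moebius_cast_le_one d).trans (by simp)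

theorem abs_moebius_sq_mul_sub_le {z m : ℕ} (hm : 0 < m) :
    |(ArithmeticFunction.moebius m : ℝ) ^ 2 * (ArithmeticFunction.moebius (m + 1) : ℝ) ^ 2 -
      truncatedSquarefree z m * truncatedSquarefree z (m + 1)| ≤
      ((largeSquareDivisors z m).card + (largeSquareDivisors z (m + 1)).card) *
        (squareDivisors (m + 1)).card := by
  have hm1 : 0 < m + 1 := by omega
  have hsplit : ∀ k : ℕ, 0 < k → (ArithmeticFunction.moebius k : ℝ) ^ 2 - truncatedSquarefree z k =
      ∑ d ∈ largeSquareDivisors z k, (ArithmeticFunction.moebius d : ℝ) := by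
    intro k hk
    rw [moebius_sq_eq_sum_squareDivisors hk, truncatedSquarefree_eq hk, largeSquareDivisors,
      ← Finset.sum_filter_add_sum_filter_not (squareDivisors k) (fun d => z < d)]
    ring
  have h1 := abs_sum_moebius_le_card (largeSquareDivisors z m)
  have h2 := abs_sum_moebius_le_card (largeSquareDivisors z (m + 1))
  rw [← hsplit m hm] at h1
  rw [← hsplit _ hm1] at h2
  have h3 : |truncatedSquarefree z (m + 1)| ≤ (squareDivisors (m + 1)).card := by
    rw [truncatedSquarefree_eq hm1]
    refine (abs_sum_moebius_le_card _).trans ?_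
    exact_mod_cast Finset.card_le_card (Finset.filter_subset _ _)
  have h4 : (1 : ℝ) ≤ (squareDivisors (m + 1)).card := by
    have : 0 < (squareDivisors (m + 1)).card :=
      Finset.card_pos.2 ⟨1, (mem_squareDivisors hm1).2 (by simp)⟩
    exact_mod_cast this
  have h5 : |(ArithmeticFunction.moebius m : ℝ) ^ 2| ≤ 1 := by
    rw [abs_pow]; exact pow_le_one₀ (abs_nonneg _) (abs_moebius_cast_le_one m)
  set A := (ArithmeticFunction.moebius m : ℝ) ^ 2
  set B := (ArithmeticFunction.moebius (m + 1) : ℝ) ^ 2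
  set a := truncatedSquarefree z m
  set b := truncatedSquarefree z (m + 1)
  -- In this splitting the untruncated factor satisfies |A| ≤ 1, so only one divisor count, that of
  -- m + 1, enters as a multiplier.
  have e : A * B - a * b = A * (B - b) + (A - a) * b := by ring
  rw [e]
  refine (abs_add_le _ _).trans ?_
  rw [abs_mul, abs_mul]
  calc |A| * |B - b| + |A - a| * |b|
      ≤ 1 * (largeSquareDivisors z (m + 1)).card +
        (largeSquareDivisors z m).card * (squareDivisors (m + 1)).card := by gcongr
    _ ≤ (squareDivisors (m + 1)).card * (largeSquareDivisors z (m + 1)).card +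
        (largeSquareDivisors z m).card * (squareDivisors (m + 1)).card := by gcongr
    _ = _ := by ring

/-- Interchange the sums: each d > z has at most M/d² multiples of d² up to M. -/
theorem sum_card_largeSquareDivisors_le (z M : ℕ) :
    ∑ m ∈ Finset.Icc 1 M, ((largeSquareDivisors z m).card : ℝ) ≤ M * (2 / ((z : ℝ) + 1)) := by
  have h1 : ∀ m ∈ Finset.Icc 1 M, ((largeSquareDivisors z m).card : ℝ) =
      ∑ d ∈ Finset.Ioo z (M + 1), if d ^ 2 ∣ m then (1 : ℝ) else 0 := by
    intro m hm
    rw [Finset.mem_Icc] at hm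
    rw [Finset.sum_boole]
    congr 2
    ext d
    simp only [largeSquareDivisors, Finset.mem_filter, mem_squareDivisors hm.1, Finset.mem_Ioo]
    constructor
    · rintro ⟨h, h'⟩
      have := (mem_squareDivisors hm.1).2 h
      simp only [squareDivisors, Finset.mem_filter, Finset.mem_Icc] at this
      exact ⟨⟨h', by omega⟩, h⟩
    · rintro ⟨⟨h, -⟩, h'⟩; exact ⟨h', h⟩
  rw [Finset.sum_congr rfl h1, Finset.sum_comm]
  calc ∑ d ∈ Finset.Ioo z (M + 1), ∑ m ∈ Finset.Icc 1 M, (if d ^ 2 ∣ m then (1 : ℝ) else 0)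
      ≤ ∑ d ∈ Finset.Ioo z (M + 1), M * ((d : ℝ) ^ 2)⁻¹ := by
        refine Finset.sum_le_sum fun d _ => ?_
        rw [Finset.sum_boole, show Finset.Icc 1 M = Finset.Ioc 0 M from rfl,
          Nat.Ioc_filter_dvd_card_eq_div, ← div_eq_mul_inv]
        exact_mod_cast Nat.cast_div_le (α := ℝ) (m := M) (n := d ^ 2)
    _ = M * ∑ d ∈ Finset.Ioo z (M + 1), ((d : ℝ) ^ 2)⁻¹ := by rw [Finset.mul_sum]
    _ ≤ _ := by
      gcongr
      exact sum_Ioo_inv_sq_le z (M + 1)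

/-! ### The density as an Euler product -/

/-- The density attached to a pair `(d, t)`; it vanishes when `d` and `t` are not coprime. -/
noncomputable def pairDensity (p : ℕ × ℕ) : ℝ :=
  (ArithmeticFunction.moebius (p.1 * p.2) : ℝ) / ((p.1 * p.2 : ℕ) : ℝ) ^ 2

theorem norm_pairDensity_le (p : ℕ × ℕ) :
    ‖pairDensity p‖ ≤ ((p.1 : ℝ) ^ 2)⁻¹ * ((p.2 : ℝ) ^ 2)⁻¹ := by
  rw [pairDensity, norm_div, Real.norm_eq_abs, Real.norm_eq_abs, ← mul_inv, ← one_div]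
  have h : |((p.1 * p.2 : ℕ) : ℝ) ^ 2| = (p.1 : ℝ) ^ 2 * (p.2 : ℝ) ^ 2 := by
    rw [abs_of_nonneg (by positivity)]; push_cast; ring
  rw [h]
  have := abs_moebius_cast_le_one (p.1 * p.2)
  gcongr

theorem summable_norm_pairDensity : Summable fun p => ‖pairDensity p‖ := by
  have h : Summable fun n : ℕ => ((n : ℝ) ^ 2)⁻¹ := Real.summable_nat_pow_inv.2 (by norm_num)
  exact Summable.of_nonneg_of_le (fun _ => norm_nonneg _) norm_pairDensity_le
    (h.mul_of_nonneg h (fun _ => by positivity) fun _ => by positivity)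

/-- The coefficients of the Dirichlet series whose Euler product is `sigma`. -/
noncomputable def sigmaCoeff (m : ℕ) : ℝ :=
  (ArithmeticFunction.moebius m : ℝ) * m.divisors.card / (m : ℝ) ^ 2

theorem tsum_preimage_mul_eq (m : ℕ) (hm : 0 < m) (F : ℕ → ℝ) :
    ∑' p : (fun p : ℕ × ℕ => p.1 * p.2) ⁻¹' {m}, F (p.1.1 * p.1.2) = m.divisors.card * F m := by
  have hset : (fun p : ℕ × ℕ => p.1 * p.2) ⁻¹' {m} = ↑(m.divisorsAntidiagonal) := by
    ext p
    simp [Nat.mem_divisorsAntidiagonal, hm.ne']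
  rw [hset]
  rw [Finset.tsum_subtype' (m.divisorsAntidiagonal) (fun p : ℕ × ℕ => F (p.1 * p.2))]
  rw [Finset.sum_congr rfl (g := fun _ => F m)
    (fun p hp => by rw [(Nat.mem_divisorsAntidiagonal.1 hp).1])]
  rw [Finset.sum_const, nsmul_eq_mul,
    ← Nat.map_div_right_divisors, Finset.card_map]

/-- Group the pairs by their product m. The density depends only on m, and m has τ(m)
factorisations, which is the source of the 2 in 1 - 2/p². -/
theorem hasSum_sigmaCoeff : HasSum sigmaCoeff (∑' p, pairDensity p) := by
  have h := summable_norm_pairDensity.of_norm.hasSum.tsum_fiberwise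
    (fun p : ℕ × ℕ => p.1 * p.2)
  suffices hfun : sigmaCoeff =
      fun m => ∑' p : (fun p : ℕ × ℕ => p.1 * p.2) ⁻¹' {m}, pairDensity p.1 by
    rw [hfun]; exact h
  funext m
  rcases Nat.eq_zero_or_pos m with rfl | hm
  · have : ∀ p : (fun p : ℕ × ℕ => p.1 * p.2) ⁻¹' {0}, pairDensity p.1 = 0 := by
      rintro ⟨p, hp⟩
      have hp' : p.1 * p.2 = 0 := hp
      simp [pairDensity, hp']
    simp [this, sigmaCoeff]
  · have := tsum_preimage_mul_eq m hm
      (fun k => (ArithmeticFunction.moebius k : ℝ) / (k : ℝ) ^ 2)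
    simp only [pairDensity]
    rw [this, sigmaCoeff]
    ring

theorem summable_norm_sigmaCoeff : Summable fun m => ‖sigmaCoeff m‖ := by
  have h := summable_norm_pairDensity.hasSum.tsum_fiberwise
    (fun p : ℕ × ℕ => p.1 * p.2)
  refine (summable_congr fun m => ?_).2 h.summable
  rcases Nat.eq_zero_or_pos m with rfl | hm
  · have : ∀ p : (fun p : ℕ × ℕ => p.1 * p.2) ⁻¹' {0}, pairDensity p.1 = 0 := by
      rintro ⟨p, hp⟩
      have hp' : p.1 * p.2 = 0 := hp
      simp [pairDensity, hp']
    simp [this, sigmaCoeff]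
  · have := tsum_preimage_mul_eq m hm
      (fun k => ‖(ArithmeticFunction.moebius k : ℝ) / (k : ℝ) ^ 2‖)
    simp only [pairDensity]
    rw [this, sigmaCoeff, mul_comm (ArithmeticFunction.moebius m : ℝ), mul_div_assoc, norm_mul]
    simp

theorem sigmaCoeff_mul {m n : ℕ} (h : m.Coprime n) :
    sigmaCoeff (m * n) = sigmaCoeff m * sigmaCoeff n := by
  simp only [sigmaCoeff]
  rw [ArithmeticFunction.isMultiplicative_moebius.map_mul_of_coprime h, h.card_divisors_mul]
  push_cast
  field_simp

theorem tsum_sigmaCoeff_prime_pow (p : Nat.Primes) :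
    ∑' e : ℕ, sigmaCoeff ((p : ℕ) ^ e) = 1 - 2 / ((p : ℕ) : ℝ) ^ 2 := by
  rw [tsum_eq_sum (s := Finset.range 2)]
  · rw [Finset.sum_range_succ, Finset.sum_range_one]
    simp only [sigmaCoeff, pow_zero, pow_one]
    rw [ArithmeticFunction.moebius_apply_prime p.2, p.2.divisors,
      Finset.card_pair p.2.one_lt.ne]
    simp
    ring
  · intro e he
    rw [Finset.mem_range, not_lt] at he
    have : ArithmeticFunction.moebius ((p : ℕ) ^ e) = 0 := by
      apply ArithmeticFunction.moebius_eq_zero_of_not_squarefree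
      intro h
      have := h p (by rw [← sq]; exact pow_dvd_pow _ he)
      exact p.2.one_lt.ne' (Nat.isUnit_iff.1 this)
    simp [sigmaCoeff, this]

theorem tsum_pairDensity : ∑' p, pairDensity p = sigma := by
  have h := EulerProduct.eulerProduct_hasProd (f := sigmaCoeff) (by simp [sigmaCoeff])
    sigmaCoeff_mul summable_norm_sigmaCoeff (by simp [sigmaCoeff])
  simp only [tsum_sigmaCoeff_prime_pow] at h
  rw [sigma, h.tprod_eq, hasSum_sigmaCoeff.tsum_eq]

theorem sum_Icc_inv_sq_le (N : ℕ) : ∑ d ∈ Finset.Icc 1 N, ((d : ℝ) ^ 2)⁻¹ ≤ 2 := by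
  have := sum_Ioo_inv_sq_le (α := ℝ) 0 (N + 1)
  have e : Finset.Ioo 0 (N + 1) = Finset.Icc 1 N := by
    ext d; simp only [Finset.mem_Ioo, Finset.mem_Icc]; omega
  rw [e] at this
  simpa using this

/-- The truncation error of the density. -/
theorem abs_sum_pairDensity_sub_sigma_le (z : ℕ) :
    |∑ p ∈ Finset.Icc 1 z ×ˢ Finset.Icc 1 z, pairDensity p - sigma| ≤ 8 / ((z : ℝ) + 1) := by
  set B : ℕ → Finset (ℕ × ℕ) := fun N => Finset.Icc 1 N ×ˢ Finset.Icc 1 N with hB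
  have hfin : ∀ N, z ≤ N →
      |∑ p ∈ B z, pairDensity p - ∑ p ∈ B N, pairDensity p| ≤ 8 / ((z : ℝ) + 1) := by
    intro N hN
    have hsub : Finset.Icc 1 z ⊆ Finset.Icc 1 N := Finset.Icc_subset_Icc le_rfl hN
    have hsubB : B z ⊆ B N := Finset.product_subset_product hsub hsub
    have hsq : ∀ M, ∑ p ∈ B M, ((p.1 : ℝ) ^ 2)⁻¹ * ((p.2 : ℝ) ^ 2)⁻¹ =
        (∑ d ∈ Finset.Icc 1 M, ((d : ℝ) ^ 2)⁻¹) ^ 2 := by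
      intro M
      rw [sq, Finset.sum_mul_sum, ← Finset.sum_product']
    have htail : ∑ d ∈ Finset.Icc 1 N, ((d : ℝ) ^ 2)⁻¹ - ∑ d ∈ Finset.Icc 1 z, ((d : ℝ) ^ 2)⁻¹ ≤
        2 / ((z : ℝ) + 1) := by
      refine le_trans (le_of_eq ?_) (sum_Ioo_inv_sq_le (α := ℝ) z (N + 1))
      rw [sub_eq_iff_eq_add, ← Finset.sum_sdiff hsub]
      congr 2
      ext d
      simp only [Finset.mem_sdiff, Finset.mem_Icc, Finset.mem_Ioo]; omega
    have hz := sum_Icc_inv_sq_le z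
    have hNb := sum_Icc_inv_sq_le N
    have hz0 : 0 ≤ ∑ d ∈ Finset.Icc 1 z, ((d : ℝ) ^ 2)⁻¹ := Finset.sum_nonneg fun _ _ => by positivity
    have hN0 : 0 ≤ ∑ d ∈ Finset.Icc 1 N, ((d : ℝ) ^ 2)⁻¹ := Finset.sum_nonneg fun _ _ => by positivity
    -- The majorant is a product, so its sum over the difference of two boxes is a difference of
    -- squares: a tail at most 2/(z+1) times a sum at most 4.
    rw [abs_sub_comm, ← Finset.sum_sdiff_eq_sub hsubB]
    calc |∑ p ∈ B N \ B z, pairDensity p|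
        ≤ ∑ p ∈ B N \ B z, ((p.1 : ℝ) ^ 2)⁻¹ * ((p.2 : ℝ) ^ 2)⁻¹ :=
          (Finset.abs_sum_le_sum_abs _ _).trans
            (Finset.sum_le_sum fun p _ => norm_pairDensity_le p)
      _ = (∑ d ∈ Finset.Icc 1 N, ((d : ℝ) ^ 2)⁻¹) ^ 2 -
          (∑ d ∈ Finset.Icc 1 z, ((d : ℝ) ^ 2)⁻¹) ^ 2 := by
        rw [Finset.sum_sdiff_eq_sub hsubB, hsq, hsq]
      _ = (∑ d ∈ Finset.Icc 1 N, ((d : ℝ) ^ 2)⁻¹ - ∑ d ∈ Finset.Icc 1 z, ((d : ℝ) ^ 2)⁻¹) *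
          (∑ d ∈ Finset.Icc 1 N, ((d : ℝ) ^ 2)⁻¹ + ∑ d ∈ Finset.Icc 1 z, ((d : ℝ) ^ 2)⁻¹) := by
        ring
      _ ≤ 2 / ((z : ℝ) + 1) * (2 + 2) := by gcongr
      _ = _ := by ring
  have hlim : Tendsto (fun N => ∑ p ∈ B N, pairDensity p) atTop (nhds sigma) := by
    have h := summable_norm_pairDensity.of_norm.hasSum
    rw [tsum_pairDensity] at h
    have hB' : ∀ N, ∑ p ∈ B N, pairDensity p =
        ∑ p ∈ Finset.range (N + 1) ×ˢ Finset.range (N + 1), pairDensity p := by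
      intro N
      refine Finset.sum_subset (fun p hp => ?_) fun p hp hp' => ?_
      · simp only [hB, Finset.mem_product, Finset.mem_Icc, Finset.mem_range] at hp ⊢
        omega
      · have : p.1 * p.2 = 0 := by
          by_contra hne
          rw [Nat.mul_eq_zero, not_or] at hne
          simp only [hB, Finset.mem_product, Finset.mem_Icc, Finset.mem_range] at hp hp'
          omega
        simp [pairDensity, this]
    simp only [hB']
    refine h.comp (Filter.tendsto_atTop_finset_of_monotone (fun M N hMN => ?_) fun p => ?_)
    · have : Finset.range (M + 1) ⊆ Finset.range (N + 1) := Finset.range_subset_range.2 (by omega)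
      exact Finset.product_subset_product this this
    · refine ⟨p.1 + p.2, ?_⟩
      simp only [Finset.mem_product, Finset.mem_range]
      omega
  refine le_of_tendsto ((tendsto_const_nhds.sub hlim).abs) ?_
  filter_upwards [eventually_ge_atTop z] with N hN using hfin N hN

theorem sigma_pos : 0 < sigma := by
  have hpos : ∀ p : Nat.Primes, 0 < 1 + -(2 / ((p : ℕ) : ℝ) ^ 2) := by
    intro p
    have h2 : (2 : ℝ) ≤ (p : ℕ) := by exact_mod_cast p.2.two_le
    have : 2 / ((p : ℕ) : ℝ) ^ 2 < 1 := by
      rw [div_lt_one (by positivity)]; nlinarith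
    linarith
  have h : Summable fun p : Nat.Primes => -(2 / ((p : ℕ) : ℝ) ^ 2) := by
    have h0 : Summable fun n : ℕ => 2 / (n : ℝ) ^ 2 := by
      simpa [div_eq_mul_inv] using
        (Real.summable_nat_pow_inv.mpr (by norm_num : 1 < 2)).mul_left (2 : ℝ)
    exact (h0.comp_injective Nat.Primes.coe_nat_injective).neg
  have := Real.rexp_tsum_eq_tprod hpos (Real.summable_log_one_add_of_summable h)
  simp only [← sub_eq_add_neg] at this
  rw [sigma, ← this]
  exact Real.exp_pos _

/-! ### Truncating the Möbius sums -/

theorem floor_rpow_injective {c : ℝ} (hc : 1 < c) :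
    Function.Injective fun n : ℕ => ⌊(n : ℝ) ^ c⌋₊ := by
  have hc0 : 0 < c := by linarith
  intro n n' h
  have h1 := (mem_Ico_ceil_rpow_inv_iff hc0 ⌊(n : ℝ) ^ c⌋₊ n).2 rfl
  have h2 := (mem_Ico_ceil_rpow_inv_iff hc0 ⌊(n : ℝ) ^ c⌋₊ n').2 h.symm
  exact Finset.card_le_one.1 (card_Ico_ceil_rpow_le_one (by positivity)
    (inv_lt_one_of_one_lt₀ hc) _) _ h1 _ h2

/-- The positive integers in `(X / 2, X]`. -/
noncomputable def dyadic (X : ℝ) : Finset ℕ :=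
  (Finset.Icc 1 ⌊X⌋₊).filter fun n : ℕ => X / 2 < (n : ℝ)

theorem floor_rpow_mem_Icc {c X : ℝ} (hc : 0 < c) (hX : 0 ≤ X) {n : ℕ} (hn : n ∈ dyadic X) :
    ⌊(n : ℝ) ^ c⌋₊ ∈ Finset.Icc 1 ⌊X ^ c⌋₊ := by
  simp only [dyadic, Finset.mem_filter, Finset.mem_Icc] at hn
  have h1 : (1 : ℝ) ≤ n := by exact_mod_cast hn.1.1
  have h2 : (n : ℝ) ≤ X := (Nat.le_floor_iff hX).1 hn.1.2
  rw [Finset.mem_Icc]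
  refine ⟨Nat.le_floor ?_, Nat.floor_mono (by gcongr)⟩
  rw [Nat.cast_one]
  exact Real.one_le_rpow h1 hc.le

theorem sum_comp_floor_rpow_le {c X : ℝ} (hc : 1 < c) (hX : 0 ≤ X) (g : ℕ → ℝ) (hg : ∀ m, 0 ≤ g m) :
    ∑ n ∈ dyadic X, g ⌊(n : ℝ) ^ c⌋₊ ≤ ∑ m ∈ Finset.Icc 1 ⌊X ^ c⌋₊, g m := by
  rw [← Finset.sum_image (f := g) (g := fun n : ℕ => ⌊(n : ℝ) ^ c⌋₊)
    (fun a _ b _ h => floor_rpow_injective hc h)]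
  refine Finset.sum_le_sum_of_subset_of_nonneg (fun m hm => ?_) fun m _ _ => hg m
  obtain ⟨n, hn, rfl⟩ := Finset.mem_image.1 hm
  exact floor_rpow_mem_Icc (by linarith) hX hn

/-- Injectivity of n ↦ [n^c] lets the sparse values be replaced by all m ≤ X^c. This loses a factor
X^(c-1), which the choice of z can afford. -/
theorem exists_abs_S_sub_truncated_le {c ε : ℝ} (hc : 1 < c) (hε : 0 < ε) :
    ∃ C : ℝ, 0 < C ∧ ∀ X : ℝ, 1 ≤ X → ∀ z : ℕ,
      |S c X - ∑ n ∈ dyadic X, truncatedSquarefree z ⌊(n : ℝ) ^ c⌋₊ *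
        truncatedSquarefree z (⌊(n : ℝ) ^ c⌋₊ + 1)| ≤ C * X ^ ε * (X ^ c / ((z : ℝ) + 1)) := by
  have hc0 : 0 < c := by linarith
  obtain ⟨C, hC1, hC⟩ := exists_card_squareDivisors_le_rpow (div_pos hε hc0)
  have hC0 : 0 < C := by linarith
  refine ⟨6 * (C * 2 ^ (ε / c)), by positivity, fun X hX z => ?_⟩
  have hX0 : 0 ≤ X := by linarith
  have hY : 1 ≤ X ^ c := Real.one_le_rpow hX hc0.le
  have hM : (⌊X ^ c⌋₊ : ℝ) ≤ X ^ c := Nat.floor_le (by positivity)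
  have hr0 : ∀ m, (0 : ℝ) ≤ (largeSquareDivisors z m).card := fun m => Nat.cast_nonneg _
  have hτ : ∀ n ∈ dyadic X, ((squareDivisors (⌊(n : ℝ) ^ c⌋₊ + 1)).card : ℝ) ≤
      C * 2 ^ (ε / c) * X ^ ε := by
    intro n hn
    have hn' := Finset.mem_Icc.1 (floor_rpow_mem_Icc hc0 hX0 hn)
    have h1 : ((⌊(n : ℝ) ^ c⌋₊ + 1 : ℕ) : ℝ) ≤ 2 * X ^ c := by
      have : (⌊(n : ℝ) ^ c⌋₊ : ℝ) ≤ ⌊X ^ c⌋₊ := by exact_mod_cast hn'.2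
      push_cast; linarith
    refine (hC _ (by omega)).trans ?_
    calc C * ((⌊(n : ℝ) ^ c⌋₊ + 1 : ℕ) : ℝ) ^ (ε / c) ≤ C * (2 * X ^ c) ^ (ε / c) := by gcongr
      _ = C * 2 ^ (ε / c) * X ^ ε := by
        rw [Real.mul_rpow (by norm_num) (by positivity), ← Real.rpow_mul hX0, mul_div_cancel₀ _
          hc0.ne', mul_assoc]
  have hs1 : ∑ n ∈ dyadic X, ((largeSquareDivisors z ⌊(n : ℝ) ^ c⌋₊).card : ℝ) ≤
      X ^ c * (2 / ((z : ℝ) + 1)) := by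
    refine (sum_comp_floor_rpow_le hc hX0 (fun m => ((largeSquareDivisors z m).card : ℝ)) hr0).trans
      ((sum_card_largeSquareDivisors_le z _).trans ?_)
    gcongr
  have hs2 : ∑ n ∈ dyadic X, ((largeSquareDivisors z (⌊(n : ℝ) ^ c⌋₊ + 1)).card : ℝ) ≤
      2 * X ^ c * (2 / ((z : ℝ) + 1)) := by
    refine (sum_comp_floor_rpow_le hc hX0 (fun m => ((largeSquareDivisors z (m + 1)).card : ℝ))
      fun m => hr0 _).trans ?_
    have : ∑ m ∈ Finset.Icc 1 ⌊X ^ c⌋₊, ((largeSquareDivisors z (m + 1)).card : ℝ) ≤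
        ∑ m ∈ Finset.Icc 1 (⌊X ^ c⌋₊ + 1), ((largeSquareDivisors z m).card : ℝ) := by
      rw [← Finset.sum_image (f := fun m => ((largeSquareDivisors z m).card : ℝ))
        (g := fun m => m + 1) (fun a _ b _ h => by simpa using h)]
      refine Finset.sum_le_sum_of_subset_of_nonneg (fun m hm => ?_) fun m _ _ => hr0 m
      obtain ⟨n, hn, rfl⟩ := Finset.mem_image.1 hm
      rw [Finset.mem_Icc] at hn ⊢
      omega
    refine this.trans ((sum_card_largeSquareDivisors_le z _).trans ?_)
    gcongr
    push_cast; linarith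
  rw [S, ← dyadic, ← Finset.sum_sub_distrib]
  refine (Finset.abs_sum_le_sum_abs _ _).trans ?_
  calc ∑ n ∈ dyadic X, |(ArithmeticFunction.moebius ⌊(n : ℝ) ^ c⌋₊ : ℝ) ^ 2 *
          (ArithmeticFunction.moebius (⌊(n : ℝ) ^ c⌋₊ + 1) : ℝ) ^ 2 -
          truncatedSquarefree z ⌊(n : ℝ) ^ c⌋₊ * truncatedSquarefree z (⌊(n : ℝ) ^ c⌋₊ + 1)|
      ≤ ∑ n ∈ dyadic X, ((largeSquareDivisors z ⌊(n : ℝ) ^ c⌋₊).card +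
          (largeSquareDivisors z (⌊(n : ℝ) ^ c⌋₊ + 1)).card) * (C * 2 ^ (ε / c) * X ^ ε) := by
        refine Finset.sum_le_sum fun n hn => ?_
        have hn' := Finset.mem_Icc.1 (floor_rpow_mem_Icc hc0 hX0 hn)
        refine (abs_moebius_sq_mul_sub_le (by omega)).trans ?_
        have := hτ n hn
        gcongr
    _ ≤ (X ^ c * (2 / ((z : ℝ) + 1)) + 2 * X ^ c * (2 / ((z : ℝ) + 1))) *
          (C * 2 ^ (ε / c) * X ^ ε) := by
        rw [← Finset.sum_mul, Finset.sum_add_distrib]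
        gcongr
    _ = _ := by ring

/-! ### The main term -/

theorem sum_truncated_mul_truncated (c X : ℝ) (z : ℕ) :
    ∑ n ∈ dyadic X, truncatedSquarefree z ⌊(n : ℝ) ^ c⌋₊ *
        truncatedSquarefree z (⌊(n : ℝ) ^ c⌋₊ + 1) =
      ∑ p ∈ Finset.Icc 1 z ×ˢ Finset.Icc 1 z,
        (ArithmeticFunction.moebius p.1 : ℝ) * ArithmeticFunction.moebius p.2 *
          ((dyadic X).filter fun n : ℕ =>
            p.1 ^ 2 ∣ ⌊(n : ℝ) ^ c⌋₊ ∧ p.2 ^ 2 ∣ ⌊(n : ℝ) ^ c⌋₊ + 1).card := by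
  have h : ∀ m : ℕ, truncatedSquarefree z m * truncatedSquarefree z (m + 1) =
      ∑ p ∈ Finset.Icc 1 z ×ˢ Finset.Icc 1 z,
        (if p.1 ^ 2 ∣ m then (ArithmeticFunction.moebius p.1 : ℝ) else 0) *
          (if p.2 ^ 2 ∣ m + 1 then (ArithmeticFunction.moebius p.2 : ℝ) else 0) := by
    intro m
    rw [truncatedSquarefree, truncatedSquarefree, Finset.sum_mul_sum, ← Finset.sum_product']
  simp only [h]
  rw [Finset.sum_comm]
  refine Finset.sum_congr rfl fun p _ => ?_
  rw [Finset.card_filter]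
  push_cast
  rw [Finset.mul_sum]
  refine Finset.sum_congr rfl fun n _ => ?_
  by_cases h1 : p.1 ^ 2 ∣ ⌊(n : ℝ) ^ c⌋₊ <;> by_cases h2 : p.2 ^ 2 ∣ ⌊(n : ℝ) ^ c⌋₊ + 1 <;>
    simp [h1, h2]

/-- Chinese remainder theorem for m ≡ 0 modulo d² and m ≡ -1 modulo t², with t² - 1 standing for -1
in ℕ. -/
theorem exists_sq_dvd_iff_mod_eq {d t : ℕ} (hd : 0 < d) (ht : 0 < t) (h : d.Coprime t) :
    ∃ a < (d * t) ^ 2, ∀ m : ℕ, (d ^ 2 ∣ m ∧ t ^ 2 ∣ m + 1) ↔ m % (d * t) ^ 2 = a := by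
  have hco : (d ^ 2).Coprime (t ^ 2) := Nat.Coprime.pow 2 2 h
  obtain ⟨k, hk1, hk2⟩ := Nat.chineseRemainder hco 0 (t ^ 2 - 1)
  have hpos : 0 < (d * t) ^ 2 := by positivity
  refine ⟨k % (d * t) ^ 2, Nat.mod_lt _ hpos, fun m => ?_⟩
  have ht2 : t ^ 2 - 1 + 1 = t ^ 2 := Nat.sub_add_cancel (by nlinarith)
  have h2 : t ^ 2 ∣ m + 1 ↔ m ≡ t ^ 2 - 1 [MOD t ^ 2] := by
    rw [← Nat.modEq_zero_iff_dvd]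
    constructor
    · intro hm
      refine Nat.ModEq.add_right_cancel' 1 ?_
      rw [ht2]
      exact hm.trans (Nat.modEq_zero_iff_dvd.2 dvd_rfl).symm
    · intro hm
      have := hm.add_right 1
      rw [ht2] at this
      exact this.trans (Nat.modEq_zero_iff_dvd.2 dvd_rfl)
  rw [h2, ← Nat.modEq_zero_iff_dvd, mul_pow]
  change _ ↔ m ≡ k [MOD d ^ 2 * t ^ 2]
  rw [← Nat.modEq_and_modEq_iff_modEq_mul hco]
  exact ⟨fun hm => ⟨hm.1.trans hk1.symm, hm.2.trans hk2.symm⟩,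
    fun hm => ⟨hm.1.trans hk1, hm.2.trans hk2⟩⟩

/-- The truncation at D gives dt ≤ D², exactly the range of the equidistribution bound. Its factor
(dt)^(-3/2) separates into two convergent sums, so nothing is lost in summing over pairs. -/
theorem exists_abs_sum_truncated_sub_le {c : ℝ} (hc₁ : 1 < c) (hc₂ : c < 7 / 6) :
    ∃ C : ℝ, 0 < C ∧ ∀ X : ℝ, 64 ≤ X →
      |∑ n ∈ dyadic X, truncatedSquarefree ⌊X ^ ((2 * c - 1) / 8)⌋₊ ⌊(n : ℝ) ^ c⌋₊ *
          truncatedSquarefree ⌊X ^ ((2 * c - 1) / 8)⌋₊ (⌊(n : ℝ) ^ c⌋₊ + 1) -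
        X / 2 * ∑ p ∈ Finset.Icc 1 ⌊X ^ ((2 * c - 1) / 8)⌋₊ ×ˢ
          Finset.Icc 1 ⌊X ^ ((2 * c - 1) / 8)⌋₊, pairDensity p| ≤
        C * (X ^ c / X ^ ((2 * c - 1) / 8)) := by
  obtain ⟨C, hC0, hC⟩ := exists_abs_residueCount_sub_le hc₁ hc₂
  have hsummable : Summable fun n : ℕ => 1 / √(n : ℝ) ^ 3 := by
    have h := Real.summable_nat_rpow_inv.2 (show (1 : ℝ) < 3 / 2 by norm_num)
    refine h.congr fun n => ?_
    rw [Real.sqrt_eq_rpow, ← Real.rpow_mul_natCast (Nat.cast_nonneg n), one_div]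
    norm_num
  set B := ∑' n : ℕ, 1 / √(n : ℝ) ^ 3 with hB
  have hB0 : 0 ≤ B := tsum_nonneg fun n => by positivity
  refine ⟨C * (B ^ 2 + 1), by positivity, fun X hX => ?_⟩
  have hX0 : 0 < X := by linarith
  set D := X ^ ((2 * c - 1) / 8) with hD
  have hD0 : 0 < D := Real.rpow_pos_of_pos hX0 _
  set z := ⌊D⌋₊ with hz
  rw [sum_truncated_mul_truncated, Finset.mul_sum, ← Finset.sum_sub_distrib]
  have hterm : ∀ p ∈ Finset.Icc 1 z ×ˢ Finset.Icc 1 z,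
      |(ArithmeticFunction.moebius p.1 : ℝ) * ArithmeticFunction.moebius p.2 *
          ((dyadic X).filter fun n : ℕ =>
            p.1 ^ 2 ∣ ⌊(n : ℝ) ^ c⌋₊ ∧ p.2 ^ 2 ∣ ⌊(n : ℝ) ^ c⌋₊ + 1).card -
        X / 2 * pairDensity p| ≤
      C * (X ^ c / D) * ((1 / √(p.1 : ℝ) ^ 3) * (1 / √(p.2 : ℝ) ^ 3)) := by
    rintro ⟨d, t⟩ hp
    simp only [Finset.mem_product, Finset.mem_Icc] at hp ⊢
    obtain ⟨⟨hd, hdz⟩, ht, htz⟩ := hp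
    by_cases hco : d.Coprime t
    · obtain ⟨a, ha, hiff⟩ := exists_sq_dvd_iff_mod_eq hd ht hco
      have hcount : ((dyadic X).filter fun n : ℕ =>
          d ^ 2 ∣ ⌊(n : ℝ) ^ c⌋₊ ∧ t ^ 2 ∣ ⌊(n : ℝ) ^ c⌋₊ + 1).card =
          residueCount c X ((d * t) ^ 2) a := by
        simp only [hiff, dyadic, residueCount, Finset.filter_filter]
      have hdD : (d : ℝ) ≤ D := (Nat.le_floor_iff hD0.le).1 hdz
      have htD : (t : ℝ) ≤ D := (Nat.le_floor_iff hD0.le).1 htz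
      have hE := hC X hX (d * t) a (Nat.mul_pos hd ht) (by
        push_cast; rw [sq]; gcongr) ha
      have hμ : (ArithmeticFunction.moebius d : ℝ) * ArithmeticFunction.moebius t =
          ArithmeticFunction.moebius (d * t) := by
        rw [ArithmeticFunction.isMultiplicative_moebius.map_mul_of_coprime hco]; push_cast; rfl
      rw [hcount, pairDensity, hμ]
      have e : (ArithmeticFunction.moebius (d * t) : ℝ) * (residueCount c X ((d * t) ^ 2) a : ℝ) -
          X / 2 * ((ArithmeticFunction.moebius (d * t) : ℝ) / ((d * t : ℕ) : ℝ) ^ 2) =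
          ArithmeticFunction.moebius (d * t) *
            ((residueCount c X ((d * t) ^ 2) a : ℝ) - X / (2 * ((d * t : ℕ) : ℝ) ^ 2)) := by
        ring
      rw [e, abs_mul]
      refine (mul_le_of_le_one_left (abs_nonneg _) (abs_moebius_cast_le_one _)).trans
        (hE.trans (le_of_eq ?_))
      push_cast
      rw [Real.sqrt_mul (Nat.cast_nonneg d), mul_pow]
      have h1 : √(d : ℝ) ≠ 0 := (Real.sqrt_pos.2 (by exact_mod_cast hd)).ne'
      have h2 : √(t : ℝ) ≠ 0 := (Real.sqrt_pos.2 (by exact_mod_cast ht)).ne'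
      field_simp
      exact hD
    -- A common prime would divide the consecutive integers m and m + 1, so the count is zero; the
    -- density vanishes too because d t is not square-free.
    · obtain ⟨ℓ, hℓ, hℓd, hℓt⟩ := Nat.Prime.not_coprime_iff_dvd.1 hco
      have hcount : ((dyadic X).filter fun n : ℕ =>
          d ^ 2 ∣ ⌊(n : ℝ) ^ c⌋₊ ∧ t ^ 2 ∣ ⌊(n : ℝ) ^ c⌋₊ + 1) = ∅ := by
        refine Finset.filter_eq_empty_iff.2 fun n _ h => ?_
        have h1 : ℓ ∣ ⌊(n : ℝ) ^ c⌋₊ := (hℓd.trans (dvd_pow_self d two_ne_zero)).trans h.1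
        have h2 : ℓ ∣ ⌊(n : ℝ) ^ c⌋₊ + 1 := (hℓt.trans (dvd_pow_self t two_ne_zero)).trans h.2
        exact hℓ.one_lt.ne' (Nat.dvd_one.1 ((Nat.dvd_add_right h1).1 h2))
      have hμ : ArithmeticFunction.moebius (d * t) = 0 := by
        apply ArithmeticFunction.moebius_eq_zero_of_not_squarefree
        intro h
        exact hℓ.one_lt.ne' (Nat.isUnit_iff.1 (h ℓ (mul_dvd_mul hℓd hℓt)))
      rw [hcount, pairDensity, hμ]
      simp only [Finset.card_empty, Nat.cast_zero, mul_zero, Int.cast_zero, zero_div, sub_zero,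
        abs_zero]
      positivity
  refine (Finset.abs_sum_le_sum_abs _ _).trans ((Finset.sum_le_sum hterm).trans ?_)
  have hsumB : ∑ n ∈ Finset.Icc 1 z, 1 / √(n : ℝ) ^ 3 ≤ B :=
    hsummable.sum_le_tsum _ fun n _ => by positivity
  have hsum0 : 0 ≤ ∑ n ∈ Finset.Icc 1 z, 1 / √(n : ℝ) ^ 3 :=
    Finset.sum_nonneg fun n _ => by positivity
  have hprod : ∑ p ∈ Finset.Icc 1 z ×ˢ Finset.Icc 1 z,
      (1 / √(p.1 : ℝ) ^ 3) * (1 / √(p.2 : ℝ) ^ 3) =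
      (∑ n ∈ Finset.Icc 1 z, 1 / √(n : ℝ) ^ 3) * ∑ n ∈ Finset.Icc 1 z, 1 / √(n : ℝ) ^ 3 := by
    rw [Finset.sum_mul_sum, ← Finset.sum_product']
  rw [← Finset.mul_sum, hprod]
  calc C * (X ^ c / D) * ((∑ n ∈ Finset.Icc 1 z, 1 / √(n : ℝ) ^ 3) *
        ∑ n ∈ Finset.Icc 1 z, 1 / √(n : ℝ) ^ 3) ≤ C * (X ^ c / D) * (B * B) := by gcongr
    _ ≤ C * (X ^ c / D) * (B ^ 2 + 1) := by gcongr; nlinarith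
    _ = _ := by ring

/-! ### Asymptotic formula and infinitude -/

theorem S_sub_main_isBigO {c : ℝ} (hc₁ : 1 < c) (hc₂ : c < 7 / 6) {ε : ℝ} (hε : 0 < ε) :
    (fun X : ℝ => S c X - 1 / 2 * sigma * X) =O[atTop]
      fun X : ℝ => X ^ ((6 * c + 1) / 8 + ε) := by
  obtain ⟨C₁, hC₁0, hC₁⟩ := exists_abs_S_sub_truncated_le hc₁ hε
  obtain ⟨C₂, hC₂0, hC₂⟩ := exists_abs_sum_truncated_sub_le hc₁ hc₂
  refine IsBigO.of_bound (C₁ + C₂ + 4) ?_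
  filter_upwards [eventually_ge_atTop 64] with X hX
  have hX0 : 0 < X := by linarith
  have hX1 : 1 ≤ X := by linarith
  have h1 := hC₁ X hX1 ⌊X ^ ((2 * c - 1) / 8)⌋₊
  have h2 := hC₂ X hX
  have h3 := abs_sum_pairDensity_sub_sigma_le ⌊X ^ ((2 * c - 1) / 8)⌋₊
  have hYD : X ^ c / X ^ ((2 * c - 1) / 8) = X ^ ((6 * c + 1) / 8) := by
    rw [← Real.rpow_sub hX0]; congr 1; ring
  have hD0 : 0 < X ^ ((2 * c - 1) / 8) := Real.rpow_pos_of_pos hX0 _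
  have hz := (Nat.lt_floor_add_one (X ^ ((2 * c - 1) / 8))).le
  rw [hYD] at h2
  set z := ⌊X ^ ((2 * c - 1) / 8)⌋₊
  set T := ∑ n ∈ dyadic X, truncatedSquarefree z ⌊(n : ℝ) ^ c⌋₊ *
    truncatedSquarefree z (⌊(n : ℝ) ^ c⌋₊ + 1)
  set P := ∑ p ∈ Finset.Icc 1 z ×ˢ Finset.Icc 1 z, pairDensity p
  set W := X ^ ((6 * c + 1) / 8) with hW
  have hW0 : 0 < W := Real.rpow_pos_of_pos hX0 _
  have hε1 : 1 ≤ X ^ ε := Real.one_le_rpow hX1 hε.le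
  have hWε : W ≤ X ^ ε * W := le_mul_of_one_le_left hW0.le hε1
  have g1 : |S c X - T| ≤ C₁ * (X ^ ε * W) := by
    refine h1.trans ?_
    rw [← hYD, mul_assoc]
    gcongr
  have g3 : |X / 2 * (P - sigma)| ≤ 4 * W := by
    rw [abs_mul, abs_of_pos (by positivity : 0 < X / 2)]
    have hXc : X ≤ X ^ c := Real.self_le_rpow_of_one_le hX1 hc₁.le
    calc X / 2 * |P - sigma| ≤ X ^ c / 2 * (8 / X ^ ((2 * c - 1) / 8)) := by
          gcongr
          exact h3.trans (by gcongr)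
      _ = 4 * (X ^ c / X ^ ((2 * c - 1) / 8)) := by ring
      _ = 4 * W := by rw [hYD]
  have e : S c X - 1 / 2 * sigma * X = (S c X - T) + (T - X / 2 * P) + X / 2 * (P - sigma) := by
    ring
  rw [Real.norm_eq_abs, Real.norm_eq_abs, Real.rpow_add hX0, ← hW,
    abs_of_pos (show 0 < W * X ^ ε by positivity), e]
  refine (abs_add_three _ _ _).trans ?_
  have : C₂ * W ≤ C₂ * (X ^ ε * W) := by gcongr
  linarith

theorem infinite_squarefree_pairs {c : ℝ} (hc₁ : 1 < c) (hc₂ : c < 7 / 6) :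
    {n : ℕ | Squarefree ⌊(n : ℝ) ^ c⌋₊ ∧ Squarefree (⌊(n : ℝ) ^ c⌋₊ + 1)}.Infinite := by
  -- With ε = (7/6 - c)/4 the exponent is θ = 1 - (7/6 - c)/2 < 1, so the error is o(X).
  set θ := (6 * c + 1) / 8 + (7 / 6 - c) / 4 with hθ
  have hθ1 : θ < 1 := by rw [hθ]; linarith
  have hO := S_sub_main_isBigO hc₁ hc₂ (show 0 < (7 / 6 - c) / 4 by linarith)
  have ho : (fun X : ℝ => S c X - 1 / 2 * sigma * X) =o[atTop] fun X : ℝ => X := by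
    refine hO.trans_isLittleO ?_
    refine (isLittleO_iff_tendsto' ?_).2 ?_
    · filter_upwards [eventually_gt_atTop 0] with X hX h using absurd h hX.ne'
    · refine (tendsto_rpow_neg_atTop (show 0 < 1 - θ by linarith)).congr' ?_
      filter_upwards [eventually_gt_atTop 0] with X hX
      rw [neg_sub, Real.rpow_sub hX, Real.rpow_one]
  rw [Set.infinite_iff_exists_gt]
  intro N
  have hσ := sigma_pos
  -- An error of at most σX/4 leaves S c X ≥ σX/4 > 0, and X ≥ 2N + 2 places every n > X/2 beyond N.
  have hev := (ho.bound (show 0 < sigma / 4 by positivity)).and (eventually_ge_atTop (2 * N + 2 : ℝ))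
  obtain ⟨X, hX, hXN⟩ := hev.exists
  have hX0 : 0 < X := by
    have : (0 : ℝ) ≤ N := Nat.cast_nonneg N
    linarith
  rw [Real.norm_eq_abs, Real.norm_eq_abs, abs_of_pos hX0] at hX
  have hS : 0 < S c X := by
    have := (abs_le.1 hX).1
    have : 0 < sigma * X := by positivity
    linarith
  rw [S] at hS
  obtain ⟨n, hn, hne⟩ := Finset.exists_ne_zero_of_sum_ne_zero hS.ne'
  rw [Finset.mem_filter] at hn
  have hμ := fun m : ℕ => ArithmeticFunction.moebius_ne_zero_iff_squarefree (n := m)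
  refine ⟨n, ⟨(hμ _).1 fun h => hne ?_, (hμ _).1 fun h => hne ?_⟩, ?_⟩
  · simp [h]
  · simp [h]
  · have : (N : ℝ) < n := by linarith [hn.2]
    exact_mod_cast this

end ConsecutiveSquarefree

theorem mainTheorem1 (c : ℝ) (hc₁ : 1 < c) (hc₂ : c < 7 / 6) :
    (∀ ε : ℝ, 0 < ε →
      (fun X : ℝ => ConsecutiveSquarefree.S c X - 1 / 2 * ConsecutiveSquarefree.sigma * X)
        =O[atTop] fun X : ℝ => X ^ ((6 * c + 1) / 8 + ε)) ∧
    {n : ℕ | Squarefree ⌊(n : ℝ) ^ c⌋₊ ∧ Squarefree (⌊(n : ℝ) ^ c⌋₊ + 1)}.Infinite :=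
  ⟨fun _ hε => ConsecutiveSquarefree.S_sub_main_isBigO hc₁ hc₂ hε,
    ConsecutiveSquarefree.infinite_squarefree_pairs hc₁ hc₂⟩
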